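/- Let $N\ge 2$ be an integer and let $1\le p\le N$ be real. Write $B_r(x_0)$ for the open ball of radius $r$ centred at $x_0$ in $\mathbb{R}^N$, and $C^\infty_0(E)$ for the smooth functions whose support is a compact subset of the open set $E\subseteq\mathbb{R}^N$. For an open set $\Omega\subseteq\mathbb{R}^N$ put \[ \lambda_p(\Omega)=\inf\left\{\int_\Omega|\nabla\varphi|^p\,dx\,:\,\varphi\in C^\infty_0(\Omega),\ \|\varphi\|_{L^p(\Omega)}=1\right\}\in[0,+\infty], \] and for an open set $E$ and a compact set $\Sigma\subseteq E$ put \[ \mathrm{cap}_p(\Sigma;E)=\inf\left\{\int_E|\nabla\varphi|^p\,dx\,:\,\varphi\in C^\infty_0(E),\ \varphi\ge 1\text{ on }\Sigma\right\}. \] For $0<\gamma<1$ the capacitary inradius $R_{p,\gamma}(\Omega)\in[0,+\infty]$ is the supremum of all $r>0$ for which there is $x_0\in\mathbb{R}^N$ with \[ \mathrm{cap}_p\left(\overline{B_r(x_0)}\setminus\Omega;B_{2r}(x_0)\right)\le\gamma\,\mathrm{cap}_p\left(\overline{B_r(x_0)};B_{2r}(x_0)\right). \] Here $\inf\emptyset=+\infty$,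 $\sup\emptyset=0$, $1/0=+\infty$ and $1/(+\infty)=0$. Then there are a constant $\sigma_{N,p}>0$, depending only on $N$ and $p$, and constants $C_{N,p,\gamma}$, depending only on $N$, $p$ and $\gamma$, with $C_{N,p,\gamma}\to+\infty$ as $\gamma\nearrow 1$, such that for every $0<\gamma<1$ and every open set $\Omega\subseteq\mathbb{R}^N$ \[ \sigma_{N,p}\,\gamma\left(\frac{1}{R_{p,\gamma}(\Omega)}\right)^p\le\lambda_p(\Omega)\le C_{N,p,\gamma}\left(\frac{1}{R_{p,\gamma}(\Omega)}\right)^p . \] The divergence cannot be avoided: if $(C_\gamma)_{0<\gamma<1}$ are real constants such that $\lambda_p(\Omega)\le C_\gamma\,R_{p,\gamma}(\Omega)^{-p}$ for every $0<\gamma<1$ and every open $\Omega\subseteq\mathbb{R}^N$, then $C_\gamma\to+\infty$ as $\gamma\nearrow1$. In particular, for every open $\Omega\subseteq\mathbb{R}^N$ and every $0<\gamma<1$, \[ \lambda_p(\Omega)>0\quad\Longleftrightarrow\quad R_{p,\gamma}(\Omega)<+\infty, \] and the condition $R_{p,\gamma}(\Omega)<+\infty$ does not depend on $\gamma\in(0,1)$: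 if it holds for one $\gamma$, it holds for all. -/

import Mathlib

open MeasureTheory Metric Set Filter Topology
open scoped ENNReal ContDiff

namespace CapInradius

/-- `φ ∈ C^∞_0(E)`: `φ` is smooth on the whole space and its support is a compact subset of `E`. -/
def IsTest {N : ℕ} (E : Set (EuclideanSpace ℝ (Fin N)))
    (φ : EuclideanSpace ℝ (Fin N) → ℝ) : Prop :=
  ContDiff ℝ ∞ φ ∧ HasCompactSupport φ ∧ tsupport φ ⊆ E

/-- The Dirichlet integral `∫_E |∇φ|^p dx`. -/
noncomputable def dirichlet {N : ℕ} (p : ℝ) (E : Set (EuclideanSpace ℝ (Fin N)))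
    (φ : EuclideanSpace ℝ (Fin N) → ℝ) : ℝ≥0∞ :=
  ∫⁻ x in E, ‖gradient φ x‖ₑ ^ p

/-- The sharp `L^p` Poincaré constant
`λ_p(Ω) = inf {∫_Ω |∇φ|^p dx : φ ∈ C^∞_0(Ω), ‖φ‖_{L^p(Ω)} = 1}`
(so that it is `+∞` for `Ω = ∅`). -/
noncomputable def poincareConst {N : ℕ} (p : ℝ) (Ω : Set (EuclideanSpace ℝ (Fin N))) : ℝ≥0∞ :=
  ⨅ (φ : EuclideanSpace ℝ (Fin N) → ℝ)
    (_ : IsTest Ω φ ∧ eLpNorm φ (ENNReal.ofReal p) (volume.restrict Ω) = 1), dirichlet p Ω φ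

/-- The `p`-capacity of a compact set `K` relative to the open set `E ⊇ K`:
`cap_p(K; E) = inf {∫_E |∇φ|^p dx : φ ∈ C^∞_0(E), φ ≥ 1 on K}`. -/
noncomputable def relCap {N : ℕ} (p : ℝ) (K E : Set (EuclideanSpace ℝ (Fin N))) : ℝ≥0∞ :=
  ⨅ (φ : EuclideanSpace ℝ (Fin N) → ℝ)
    (_ : IsTest E φ ∧ ∀ x ∈ K, 1 ≤ φ x), dirichlet p E φ

/-- A compact set `K` contained in the closed ball of radius `r` centred at `x₀` is
`(p, γ)`-negligible if its capacity relative to the concentric open ball of radius `2r` is at most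
`γ` times that of the closed ball. -/
def IsNegligible {N : ℕ} (p γ : ℝ) (x₀ : EuclideanSpace ℝ (Fin N)) (r : ℝ)
    (K : Set (EuclideanSpace ℝ (Fin N))) : Prop :=
  relCap p K (ball x₀ (2 * r)) ≤
    ENNReal.ofReal γ * relCap p (closedBall x₀ r) (ball x₀ (2 * r))

/-- The capacitary inradius `R_{p,γ}(Ω)`, an extended number in `[0, +∞]`
(the supremum of the empty set is `0`). -/
noncomputable def capInradius {N : ℕ} (p γ : ℝ) (Ω : Set (EuclideanSpace ℝ (Fin N))) : ℝ≥0∞ :=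
  ⨆ (r : ℝ) (_ : 0 < r ∧ ∃ x₀ : EuclideanSpace ℝ (Fin N),
    IsNegligible p γ x₀ r (closedBall x₀ r \ Ω)), ENNReal.ofReal r

end CapInradius

/-! Affine maps multiply both capacities in `IsNegligible` by the same factor and rescale
`poincareConst` by a power of the radius, so each bound reduces to balls of radius one.

Lower bound. Suppose no unit ball is negligible and let `u` be a test function in `Ω`. On `ball y 2`
some value `m` of `u` satisfies `∫ |u - m|^p ≤ A ∫ |∇u|^p`. With a cutoff `η` equal to one on the
unit ball, `η (m - u) / m` competes for the capacity of the part of the unit ball outside `Ω`, where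
`u = 0`. That capacity exceeds `γ` times the capacity of the ball, hence `γ |m|^p` is controlled by
`∫ |∇u|^p`. The resulting local Poincaré inequality (`exists_local_poincare`) is integrated over all
centres `y`.

Upper bound (`exists_upper_const`). Suppose the unit ball is negligible, and let `u`, with values in
`[0, 1]`, be a competitor for the removed set that equals one near it. Then `η (1 - u)` is a test
function in `Ω` with bounded energy, and only a lower bound for its norm is missing. By left
continuity some smaller ball still has capacity above the energy of `u`. Raising `u` to one on that
ball must therefore cost energy, and the cost is at most a multiple of the `L^p` norm of `1 - u`.

Blow-up. A thin shell around the unit sphere has small volume, hence a large Poincaré constant. It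
leaves out of the closed unit ball only a smaller concentric ball, of strictly smaller capacity
(`relCap_closedBall_lt`). For `γ` near one the unit ball is thus negligible, so the inradius is at
least one and the constant must be large. -/

namespace CapInradius

/-! ### Test functions, energy, and homogeneous forms of the two infima -/

variable {N : ℕ}

/-- The `p`-energy of `φ`, integrated over the whole space. -/
noncomputable def energy (p : ℝ) (φ : EuclideanSpace ℝ (Fin N) → ℝ) : ℝ≥0∞ :=
  ∫⁻ x, ‖fderiv ℝ φ x‖ₑ ^ p

theorem enorm_gradient (φ : EuclideanSpace ℝ (Fin N) → ℝ) (x : EuclideanSpace ℝ (Fin N)) :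
    ‖gradient φ x‖ₑ = ‖fderiv ℝ φ x‖ₑ := by
  rw [gradient, LinearIsometryEquiv.enorm_map]

theorem setLIntegral_fderiv_eq_energy {p : ℝ} (hp : 0 < p) {E : Set (EuclideanSpace ℝ (Fin N))}
    {φ : EuclideanSpace ℝ (Fin N) → ℝ} (h : tsupport φ ⊆ E) :
    ∫⁻ x in E, ‖fderiv ℝ φ x‖ₑ ^ p = energy p φ := by
  refine setLIntegral_eq_of_support_subset (fun x hx => ?_)
  by_contra hxE
  have : fderiv ℝ φ x = 0 := by
    by_contra h0
    exact hxE (h (support_fderiv_subset ℝ h0))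
  refine hx ?_
  simp only [← ofReal_norm, this]
  simp [hp]

theorem IsTest.dirichlet_eq {p : ℝ} (hp : 0 < p) {E : Set (EuclideanSpace ℝ (Fin N))}
    {φ : EuclideanSpace ℝ (Fin N) → ℝ} (h : IsTest E φ) : dirichlet p E φ = energy p φ := by
  rw [dirichlet, ← setLIntegral_fderiv_eq_energy hp h.2.2]
  simp_rw [enorm_gradient]

theorem IsTest.contDiff_one {E : Set (EuclideanSpace ℝ (Fin N))}
    {φ : EuclideanSpace ℝ (Fin N) → ℝ} (h : IsTest E φ) : ContDiff ℝ 1 φ :=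
  h.1.of_le (by exact_mod_cast le_top)

theorem IsTest.differentiable {E : Set (EuclideanSpace ℝ (Fin N))}
    {φ : EuclideanSpace ℝ (Fin N) → ℝ} (h : IsTest E φ) : Differentiable ℝ φ :=
  h.1.differentiable (by simp)

theorem IsTest.mono {E F : Set (EuclideanSpace ℝ (Fin N))} (hEF : E ⊆ F)
    {φ : EuclideanSpace ℝ (Fin N) → ℝ} (h : IsTest E φ) : IsTest F φ :=
  ⟨h.1, h.2.1, h.2.2.trans hEF⟩

theorem IsTest.const_mul {E : Set (EuclideanSpace ℝ (Fin N))}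
    {φ : EuclideanSpace ℝ (Fin N) → ℝ} (h : IsTest E φ) (a : ℝ) :
    IsTest E (fun x => a * φ x) :=
  ⟨contDiff_const.mul h.1, h.2.1.mul_left, (tsupport_mul_subset_right).trans h.2.2⟩

theorem IsTest.add {E : Set (EuclideanSpace ℝ (Fin N))}
    {φ ψ : EuclideanSpace ℝ (Fin N) → ℝ} (h : IsTest E φ) (hψ : IsTest E ψ) :
    IsTest E (fun x => φ x + ψ x) :=
  ⟨h.1.add hψ.1, h.2.1.add hψ.2.1, (tsupport_add φ ψ).trans (union_subset h.2.2 hψ.2.2)⟩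

/-- The product of a test function and a smooth function is a test function. -/
theorem IsTest.mul_contDiff {E : Set (EuclideanSpace ℝ (Fin N))}
    {φ f : EuclideanSpace ℝ (Fin N) → ℝ} (h : IsTest E φ) (hf : ContDiff ℝ ∞ f) :
    IsTest E (fun x => φ x * f x) :=
  ⟨h.1.mul hf, h.2.1.mul_right, (tsupport_mul_subset_left).trans h.2.2⟩

theorem energy_const_mul {p : ℝ} (hp : 0 ≤ p) {φ : EuclideanSpace ℝ (Fin N) → ℝ}
    (h : Differentiable ℝ φ) (a : ℝ) :
    energy p (fun x => a * φ x) = ‖a‖ₑ ^ p * energy p φ := by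
  unfold energy
  rw [← lintegral_const_mul' _ _ (ENNReal.rpow_ne_top_of_nonneg hp enorm_ne_top)]
  refine lintegral_congr fun x => ?_
  rw [fderiv_const_mul (h x), enorm_smul, ENNReal.mul_rpow_of_nonneg _ _ hp]

theorem IsTest.lintegral_enorm_rpow_lt_top {p : ℝ} (hp : 0 < p)
    {E : Set (EuclideanSpace ℝ (Fin N))}
    {φ : EuclideanSpace ℝ (Fin N) → ℝ} (h : IsTest E φ) : ∫⁻ x, ‖φ x‖ₑ ^ p < ⊤ := by
  have h1 := (h.1.continuous.memLp_of_hasCompactSupport (μ := volume) (p := ENNReal.ofReal p)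
    h.2.1)
  have := lintegral_rpow_enorm_lt_top_of_eLpNorm_lt_top (by simpa using hp)
    ENNReal.ofReal_ne_top h1.2
  rwa [ENNReal.toReal_ofReal hp.le] at this

theorem IsTest.eLpNorm_eq_one_iff {p : ℝ} (hp : 0 < p)
    {E : Set (EuclideanSpace ℝ (Fin N))}
    {φ : EuclideanSpace ℝ (Fin N) → ℝ} (h : IsTest E φ) :
    eLpNorm φ (ENNReal.ofReal p) (volume.restrict E) = 1 ↔ ∫⁻ x, ‖φ x‖ₑ ^ p = 1 := by
  rw [eLpNorm_eq_lintegral_rpow_enorm_toReal (by simpa using hp) ENNReal.ofReal_ne_top,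
    ENNReal.toReal_ofReal hp.le, setLIntegral_eq_of_support_subset]
  · rw [one_div]
    exact ⟨fun h1 => by rw [← ENNReal.rpow_inv_rpow hp.ne' (∫⁻ x, ‖φ x‖ₑ ^ p), h1,
      ENNReal.one_rpow], fun h1 => by rw [h1, ENNReal.one_rpow]⟩
  · intro x hx
    refine h.2.2 (subset_tsupport _ ?_)
    intro h0
    simp [h0, hp] at hx

theorem poincareConst_mul_le {p : ℝ} (hp : 0 < p) {Ω : Set (EuclideanSpace ℝ (Fin N))}
    {φ : EuclideanSpace ℝ (Fin N) → ℝ} (h : IsTest Ω φ) :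
    poincareConst p Ω * ∫⁻ x, ‖φ x‖ₑ ^ p ≤ energy p φ := by
  set I := ∫⁻ x, ‖φ x‖ₑ ^ p with hI
  have hItop : I ≠ ⊤ := (h.lintegral_enorm_rpow_lt_top hp).ne
  -- Here the convention `⊤ * 0 = 0` covers an infinite Poincaré constant.
  rcases eq_or_ne I 0 with h0 | h0
  · simp [h0]
  set a : ℝ := (I ^ (-p⁻¹)).toReal with ha
  have ha' : ‖a‖ₑ = I ^ (-p⁻¹) := by
    rw [ha, Real.enorm_eq_ofReal ENNReal.toReal_nonneg, ENNReal.ofReal_toReal]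
    exact ENNReal.rpow_ne_top_of_ne_zero h0 hItop
  have hap : ‖a‖ₑ ^ p = I⁻¹ := by
    rw [ha', ← ENNReal.rpow_mul]
    rw [neg_mul, inv_mul_cancel₀ hp.ne', ENNReal.rpow_neg_one]
  have h1 : IsTest Ω (fun x => a * φ x) := h.const_mul a
  have h2 : ∫⁻ x, ‖a * φ x‖ₑ ^ p = 1 := by
    simp_rw [enorm_mul, ENNReal.mul_rpow_of_nonneg _ _ hp.le]
    rw [lintegral_const_mul' _ _ (by simp [hap, h0]), hap]
    exact ENNReal.inv_mul_cancel h0 hItop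
  have h3 : poincareConst p Ω ≤ I⁻¹ * energy p φ := by
    rw [← hap, ← energy_const_mul hp.le h.differentiable, ← h1.dirichlet_eq hp]
    exact iInf₂_le _ ⟨h1, (h1.eLpNorm_eq_one_iff hp).2 h2⟩
  calc poincareConst p Ω * I ≤ I⁻¹ * energy p φ * I := by gcongr
    _ = energy p φ := by
      rw [mul_comm, ← mul_assoc, ENNReal.mul_inv_cancel h0 hItop, one_mul]

theorem le_poincareConst {p : ℝ} (hp : 0 < p) {Ω : Set (EuclideanSpace ℝ (Fin N))} {a : ℝ≥0∞}
    (h : ∀ φ, IsTest Ω φ → a * ∫⁻ x, ‖φ x‖ₑ ^ p ≤ energy p φ) : a ≤ poincareConst p Ω := by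
  refine le_iInf₂ fun φ hφ => ?_
  have := h φ hφ.1
  rwa [(hφ.1.eLpNorm_eq_one_iff hp).1 hφ.2, mul_one, ← hφ.1.dirichlet_eq hp] at this

theorem relCap_le {p : ℝ} (hp : 0 < p) {K E : Set (EuclideanSpace ℝ (Fin N))}
    {φ : EuclideanSpace ℝ (Fin N) → ℝ} (h : IsTest E φ) (hK : ∀ x ∈ K, 1 ≤ φ x) :
    relCap p K E ≤ energy p φ := by
  rw [← h.dirichlet_eq hp]
  exact iInf₂_le φ ⟨h, hK⟩

theorem le_relCap {p : ℝ} (hp : 0 < p) {K E : Set (EuclideanSpace ℝ (Fin N))} {a : ℝ≥0∞}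
    (h : ∀ φ, IsTest E φ → (∀ x ∈ K, 1 ≤ φ x) → a ≤ energy p φ) : a ≤ relCap p K E := by
  refine le_iInf₂ fun φ hφ => ?_
  rw [hφ.1.dirichlet_eq hp]
  exact h φ hφ.1 hφ.2

theorem exists_of_relCap_lt {p : ℝ} (hp : 0 < p) {K E : Set (EuclideanSpace ℝ (Fin N))} {a : ℝ≥0∞}
    (h : relCap p K E < a) : ∃ φ, IsTest E φ ∧ (∀ x ∈ K, 1 ≤ φ x) ∧ energy p φ < a := by
  by_contra! hc
  exact absurd h (not_lt.2 (le_relCap hp fun φ h1 h2 => hc φ h1 h2))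

theorem relCap_mono {p : ℝ} (hp : 0 < p) {K K' E E' : Set (EuclideanSpace ℝ (Fin N))}
    (hK : K ⊆ K') (hE : E' ⊆ E) : relCap p K E ≤ relCap p K' E' :=
  le_relCap hp fun _ h1 h2 => relCap_le hp (h1.mono hE) fun x hx => h2 x (hK hx)

/-- Division by `m`, of either sign, gives a competitor. This is the form applied to `η (m - u)`,
where nothing is known about `m`. -/
theorem relCap_mul_le {p : ℝ} (hp : 0 < p) {K E : Set (EuclideanSpace ℝ (Fin N))}
    {φ : EuclideanSpace ℝ (Fin N) → ℝ} (h : IsTest E φ) {m : ℝ} (hK : ∀ x ∈ K, φ x = m) :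
    relCap p K E * ‖m‖ₑ ^ p ≤ energy p φ := by
  rcases eq_or_ne m 0 with rfl | hm
  · simp [hp]
  have h1 := relCap_le hp (h.const_mul m⁻¹) (K := K) fun x hx => by
    rw [hK x hx, inv_mul_cancel₀ hm]
  rw [energy_const_mul hp.le h.differentiable, enorm_inv hm, ENNReal.inv_rpow] at h1
  have h0 : ‖m‖ₑ ^ p ≠ 0 := by simp [hm]
  have ht : ‖m‖ₑ ^ p ≠ ⊤ := by simp [hp.le]
  calc relCap p K E * ‖m‖ₑ ^ p ≤ (‖m‖ₑ ^ p)⁻¹ * energy p φ * ‖m‖ₑ ^ p := by gcongr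
    _ = energy p φ := by
      rw [mul_comm, ← mul_assoc, ENNReal.mul_inv_cancel h0 ht, one_mul]

/-! ### Translations and dilations -/

theorem lintegral_comp_affine (f : EuclideanSpace ℝ (Fin N) → ℝ≥0∞)
    (a : EuclideanSpace ℝ (Fin N)) {r : ℝ} (hr : 0 < r) :
    ∫⁻ x, f (a + r • x) = (ENNReal.ofReal r ^ N)⁻¹ * ∫⁻ x, f x := by
  have h1 : ∫⁻ x, f (a + r • x) =
      ∫⁻ y, f (a + y) ∂(Measure.map (fun x => r • x) volume) := by
    exact ((Homeomorph.smulOfNeZero r hr.ne').measurableEmbedding.lintegral_map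
      (fun y => f (a + y))).symm
  rw [h1, Measure.map_addHaar_smul _ hr.ne', lintegral_smul_measure,
    lintegral_add_left_eq_self (μ := volume) f a]
  congr 1
  rw [finrank_euclideanSpace_fin, abs_of_pos (by positivity),
    ENNReal.ofReal_inv_of_pos (by positivity), ENNReal.ofReal_pow hr.le]

theorem IsTest.comp_affine {E : Set (EuclideanSpace ℝ (Fin N))}
    {φ : EuclideanSpace ℝ (Fin N) → ℝ} (h : IsTest E φ)
    (a : EuclideanSpace ℝ (Fin N)) {r : ℝ} (hr : 0 < r) :
    IsTest ((fun x => a + r • x) ⁻¹' E) (fun x => φ (a + r • x)) := by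
  let T : EuclideanSpace ℝ (Fin N) ≃ₜ EuclideanSpace ℝ (Fin N) :=
    (Homeomorph.smulOfNeZero r hr.ne').trans (Homeomorph.addLeft a)
  refine ⟨h.1.comp (by fun_prop), h.2.1.comp_homeomorph T, ?_⟩
  have := tsupport_comp_subset_preimage φ T.continuous
  exact this.trans (preimage_mono h.2.2)

theorem energy_comp_affine {p : ℝ} (hp : 0 ≤ p) {φ : EuclideanSpace ℝ (Fin N) → ℝ}
    (h : Differentiable ℝ φ) (a : EuclideanSpace ℝ (Fin N)) {r : ℝ} (hr : 0 < r) :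
    energy p (fun x => φ (a + r • x)) =
      ENNReal.ofReal r ^ p * (ENNReal.ofReal r ^ N)⁻¹ * energy p φ := by
  unfold energy
  rw [mul_assoc, ← lintegral_comp_affine _ a hr,
    ← lintegral_const_mul' _ _ (ENNReal.rpow_ne_top_of_nonneg hp ENNReal.ofReal_ne_top)]
  refine lintegral_congr fun x => ?_
  have h1 : HasFDerivAt (fun x : EuclideanSpace ℝ (Fin N) => a + r • x)
      (r • ContinuousLinearMap.id ℝ _) x :=
    ((hasFDerivAt_id x).const_smul r).const_add a
  have h2 := ((h (a + r • x)).hasFDerivAt.comp x h1).fderiv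
  have h3 : fderiv ℝ (fun x => φ (a + r • x)) x = r • fderiv ℝ φ (a + r • x) := by
    rw [show (fun x => φ (a + r • x)) = φ ∘ (fun x => a + r • x) from rfl, h2]
    ext v; simp
  rw [h3, enorm_smul, ENNReal.mul_rpow_of_nonneg _ _ hp, Real.enorm_eq_ofReal hr.le]

theorem preimage_affine_inverse (E : Set (EuclideanSpace ℝ (Fin N)))
    (a : EuclideanSpace ℝ (Fin N)) {r : ℝ} (hr : 0 < r) :
    (fun x => -(r⁻¹ • a) + r⁻¹ • x) ⁻¹' ((fun x => a + r • x) ⁻¹' E) = E := by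
  ext x
  simp [smul_smul, hr.ne']

/-- Competitors pull back under the affine map. The reverse inequality is this one applied to the
inverse map. -/
theorem relCap_preimage_affine_le {p : ℝ} (hp : 0 < p) (K E : Set (EuclideanSpace ℝ (Fin N)))
    (a : EuclideanSpace ℝ (Fin N)) {r : ℝ} (hr : 0 < r) :
    (ENNReal.ofReal r ^ p)⁻¹ * ENNReal.ofReal r ^ N *
      relCap p ((fun x => a + r • x) ⁻¹' K) ((fun x => a + r • x) ⁻¹' E) ≤ relCap p K E := by
  have hr0 : ENNReal.ofReal r ≠ 0 := by simpa using hr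
  have hp0 : ENNReal.ofReal r ^ p ≠ 0 := by simp [hr]
  have hpt : ENNReal.ofReal r ^ p ≠ ⊤ := by simp [hp.le]
  have hN0 : ENNReal.ofReal r ^ N ≠ 0 := pow_ne_zero _ hr0
  have hNt : ENNReal.ofReal r ^ N ≠ ⊤ := by simp
  refine le_relCap hp fun φ h1 h2 => ?_
  have h3 := relCap_le hp (h1.comp_affine a hr) (K := (fun x => a + r • x) ⁻¹' K)
    fun x hx => h2 _ hx
  rw [energy_comp_affine hp.le h1.differentiable a hr] at h3
  refine (mul_le_mul_right h3 _).trans (le_of_eq ?_)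
  generalize ENNReal.ofReal r ^ p = A at *
  generalize ENNReal.ofReal r ^ N = B at *
  calc A⁻¹ * B * (A * B⁻¹ * energy p φ) = (A⁻¹ * A) * (B * B⁻¹) * energy p φ := by ring
    _ = _ := by rw [ENNReal.inv_mul_cancel hp0 hpt, ENNReal.mul_inv_cancel hN0 hNt]; simp

theorem relCap_preimage_affine {p : ℝ} (hp : 0 < p) (K E : Set (EuclideanSpace ℝ (Fin N)))
    (a : EuclideanSpace ℝ (Fin N)) {r : ℝ} (hr : 0 < r) :
    relCap p ((fun x => a + r • x) ⁻¹' K) ((fun x => a + r • x) ⁻¹' E) =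
      ENNReal.ofReal r ^ p * (ENNReal.ofReal r ^ N)⁻¹ * relCap p K E := by
  have hr0 : ENNReal.ofReal r ≠ 0 := by simpa using hr
  have hp0 : ENNReal.ofReal r ^ p ≠ 0 := by simp [hr]
  have hpt : ENNReal.ofReal r ^ p ≠ ⊤ := by simp [hp.le]
  have hN0 : ENNReal.ofReal r ^ N ≠ 0 := pow_ne_zero _ hr0
  have hNt : ENNReal.ofReal r ^ N ≠ ⊤ := by simp
  apply le_antisymm
  · have h1 := relCap_preimage_affine_le hp K E a hr
    generalize ENNReal.ofReal r ^ p = A at *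
    generalize ENNReal.ofReal r ^ N = B at *
    refine le_trans (le_of_eq ?_) (mul_le_mul_right h1 _)
    generalize relCap p ((fun x => a + r • x) ⁻¹' K) ((fun x => a + r • x) ⁻¹' E) = X
    calc X = (A⁻¹ * A) * (B * B⁻¹) * X := by
          rw [ENNReal.inv_mul_cancel hp0 hpt, ENNReal.mul_inv_cancel hN0 hNt]; simp
      _ = _ := by ring
  · have h1 := relCap_preimage_affine_le hp ((fun x => a + r • x) ⁻¹' K)
      ((fun x => a + r • x) ⁻¹' E) (-(r⁻¹ • a)) (inv_pos.2 hr)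
    rwa [preimage_affine_inverse _ _ hr, preimage_affine_inverse _ _ hr,
      ENNReal.ofReal_inv_of_pos hr, ENNReal.inv_rpow, inv_inv, ← ENNReal.inv_pow] at h1

theorem preimage_affine_ball (a y : EuclideanSpace ℝ (Fin N)) {r s : ℝ} (hr : 0 < r) :
    (fun x => a + r • x) ⁻¹' (ball (a + r • y) (r * s)) = ball y s := by
  ext x
  simp only [mem_preimage, mem_ball, dist_add_left, dist_smul₀, Real.norm_eq_abs, abs_of_pos hr]
  exact mul_lt_mul_iff_right₀ hr

theorem preimage_affine_closedBall (a y : EuclideanSpace ℝ (Fin N)) {r s : ℝ} (hr : 0 < r) :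
    (fun x => a + r • x) ⁻¹' (closedBall (a + r • y) (r * s)) = closedBall y s := by
  ext x
  simp only [mem_preimage, mem_closedBall, dist_add_left, dist_smul₀, Real.norm_eq_abs,
    abs_of_pos hr]
  exact mul_le_mul_iff_right₀ hr

/-- Both capacities acquire the same finite nonzero factor `r ^ (p - N)`, which cancels. -/
theorem isNegligible_preimage_affine {p : ℝ} (hp : 0 < p) (γ : ℝ)
    (Ω : Set (EuclideanSpace ℝ (Fin N))) (a y : EuclideanSpace ℝ (Fin N)) {r : ℝ} (hr : 0 < r) :
    IsNegligible p γ y 1 (closedBall y 1 \ (fun x => a + r • x) ⁻¹' Ω) ↔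
      IsNegligible p γ (a + r • y) r (closedBall (a + r • y) r \ Ω) := by
  have hr0 : ENNReal.ofReal r ≠ 0 := by simpa using hr
  have hp0 : ENNReal.ofReal r ^ p ≠ 0 := by simp [hr]
  have hpt : ENNReal.ofReal r ^ p ≠ ⊤ := by simp [hp.le]
  have hN0 : ENNReal.ofReal r ^ N ≠ 0 := pow_ne_zero _ hr0
  have hNt : ENNReal.ofReal r ^ N ≠ ⊤ := by simp
  have e1 : closedBall y 1 = (fun x => a + r • x) ⁻¹' closedBall (a + r • y) r := by
    rw [← preimage_affine_closedBall a y hr, mul_one]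
  have e2 : ball y (2 * 1) = (fun x => a + r • x) ⁻¹' ball (a + r • y) (2 * r) := by
    rw [← preimage_affine_ball a y hr, mul_one, mul_comm]
  unfold IsNegligible
  rw [e1, e2, ← preimage_sdiff, relCap_preimage_affine hp _ _ a hr,
    relCap_preimage_affine hp _ _ a hr, mul_left_comm]
  refine ENNReal.mul_le_mul_iff_right (mul_ne_zero hp0 (ENNReal.inv_ne_zero.2 hNt))
    (ENNReal.mul_ne_top hpt (ENNReal.inv_ne_top.2 hN0))

theorem poincareConst_preimage_affine_le {p : ℝ} (hp : 0 < p)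
    (Ω : Set (EuclideanSpace ℝ (Fin N))) (a : EuclideanSpace ℝ (Fin N)) {r : ℝ} (hr : 0 < r) :
    (ENNReal.ofReal r ^ p)⁻¹ * poincareConst p ((fun x => a + r • x) ⁻¹' Ω) ≤
      poincareConst p Ω := by
  have hr0 : ENNReal.ofReal r ≠ 0 := by simpa using hr
  have hp0 : ENNReal.ofReal r ^ p ≠ 0 := by simp [hr]
  have hpt : ENNReal.ofReal r ^ p ≠ ⊤ := by simp [hp.le]
  have hN0 : ENNReal.ofReal r ^ N ≠ 0 := pow_ne_zero _ hr0
  have hNt : ENNReal.ofReal r ^ N ≠ ⊤ := by simp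
  refine le_poincareConst hp fun φ hφ => ?_
  have h1 := poincareConst_mul_le hp (hφ.comp_affine a hr)
  rw [energy_comp_affine hp.le hφ.differentiable a hr,
    lintegral_comp_affine (fun x => ‖φ x‖ₑ ^ p) a hr] at h1
  generalize ENNReal.ofReal r ^ p = A at *
  generalize ENNReal.ofReal r ^ N = B at *
  generalize poincareConst p ((fun x => a + r • x) ⁻¹' Ω) = X at *
  generalize ∫⁻ x, ‖φ x‖ₑ ^ p = I at *
  calc A⁻¹ * X * I = A⁻¹ * (B * B⁻¹) * X * I := by rw [ENNReal.mul_inv_cancel hN0 hNt, mul_one]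
    _ = A⁻¹ * B * (X * (B⁻¹ * I)) := by ring
    _ ≤ A⁻¹ * B * (A * B⁻¹ * energy p φ) := by gcongr
    _ = (A⁻¹ * A) * (B * B⁻¹) * energy p φ := by ring
    _ = _ := by rw [ENNReal.inv_mul_cancel hp0 hpt, ENNReal.mul_inv_cancel hN0 hNt]; simp

/-! ### Poincaré inequalities on balls -/

theorem continuous_enorm_rpow {p : ℝ} {u : EuclideanSpace ℝ (Fin N) → ℝ}
    (hu : Continuous u) : Continuous fun x => ‖u x‖ₑ ^ p :=
  ENNReal.continuous_rpow_const.comp hu.enorm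

theorem continuous_enorm_fderiv_rpow {p : ℝ} {u : EuclideanSpace ℝ (Fin N) → ℝ}
    (hu : ContDiff ℝ 1 u) : Continuous fun x => ‖fderiv ℝ u x‖ₑ ^ p :=
  ENNReal.continuous_rpow_const.comp (hu.continuous_fderiv (by simp)).enorm

/-- The fundamental theorem of calculus on the segment from `y` to `x`, then Hölder's inequality on
the probability space `[0, 1]`. -/
theorem enorm_sub_rpow_le {p : ℝ} (hp : 1 ≤ p) {u : EuclideanSpace ℝ (Fin N) → ℝ}
    (hu : ContDiff ℝ 1 u) (x y : EuclideanSpace ℝ (Fin N)) :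
    ‖u x - u y‖ₑ ^ p ≤
      ‖x - y‖ₑ ^ p * ∫⁻ t in Icc (0 : ℝ) 1, ‖fderiv ℝ u (y + t • (x - y))‖ₑ ^ p := by
  have hp0 : 0 < p := by linarith
  have hline : ∀ t : ℝ, HasDerivAt (fun t : ℝ => u (y + t • (x - y)))
      (fderiv ℝ u (y + t • (x - y)) (x - y)) t := fun t => by
    have h1 : HasDerivAt (fun t : ℝ => y + t • (x - y)) (x - y) t := by
      simpa using ((hasDerivAt_id t).smul_const (x - y)).const_add y
    exact ((hu.differentiable (by simp)) _).hasFDerivAt.comp_hasDerivAt t h1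
  have hF : Continuous fun t : ℝ => fderiv ℝ u (y + t • (x - y)) :=
    (hu.continuous_fderiv (by simp)).comp (by fun_prop)
  have h1 : ‖u x - u y‖ₑ ≤
      ‖x - y‖ₑ * ∫⁻ t in Icc (0 : ℝ) 1, ‖fderiv ℝ u (y + t • (x - y))‖ₑ := by
    have h2 := enorm_sub_le_lintegral_deriv_of_contDiffOn_Icc
      (f := fun t : ℝ => u (y + t • (x - y))) (a := 0) (b := 1)
      ((hu.comp (by fun_prop)).contDiffOn) zero_le_one
    simp only [one_smul, zero_smul, add_zero, add_sub_cancel] at h2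
    refine h2.trans ?_
    rw [← lintegral_const_mul' _ _ enorm_ne_top]
    refine lintegral_mono fun t => ?_
    rw [(hline t).deriv, mul_comm]
    exact ContinuousLinearMap.le_opENorm _ _
  have hprob : IsProbabilityMeasure (volume.restrict (Icc (0 : ℝ) 1)) := ⟨by simp⟩
  have h3 := eLpNorm'_le_eLpNorm'_of_exponent_le (p := 1) (q := p) one_pos hp
    (volume.restrict (Icc (0 : ℝ) 1)) hF.aestronglyMeasurable
  simp only [eLpNorm', ENNReal.rpow_one, div_one, one_div] at h3
  calc ‖u x - u y‖ₑ ^ p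
      ≤ (‖x - y‖ₑ * ∫⁻ t in Icc (0 : ℝ) 1, ‖fderiv ℝ u (y + t • (x - y))‖ₑ) ^ p := by gcongr
    _ = ‖x - y‖ₑ ^ p * (∫⁻ t in Icc (0 : ℝ) 1, ‖fderiv ℝ u (y + t • (x - y))‖ₑ) ^ p :=
        ENNReal.mul_rpow_of_nonneg _ _ hp0.le
    _ ≤ _ := by
        gcongr
        exact (ENNReal.le_rpow_inv_iff hp0).1 h3

/-- Convexity keeps the combination in `s`, and a contraction with ratio at least `1 / 2` has
Jacobian at least `2 ^ (-N)`. -/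
theorem setLIntegral_comp_combo_le {s : Set (EuclideanSpace ℝ (Fin N))} (hs : MeasurableSet s)
    (hconv : Convex ℝ s) (g : EuclideanSpace ℝ (Fin N) → ℝ≥0∞)
    {z : EuclideanSpace ℝ (Fin N)} (hz : z ∈ s) {a : ℝ} (ha : 1 / 2 ≤ a) (ha1 : a ≤ 1) :
    ∫⁻ y in s, g ((1 - a) • z + a • y) ≤ 2 ^ N * ∫⁻ y in s, g y := by
  have ha0 : 0 < a := by linarith
  calc ∫⁻ y in s, g ((1 - a) • z + a • y)
      ≤ ∫⁻ y in s, s.indicator g ((1 - a) • z + a • y) := by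
        refine setLIntegral_mono' hs fun y hy => ?_
        rw [indicator_of_mem (hconv hz hy (by linarith) ha0.le (by ring))]
    _ ≤ ∫⁻ y, s.indicator g ((1 - a) • z + a • y) := setLIntegral_le_lintegral _ _
    _ = (ENNReal.ofReal a ^ N)⁻¹ * ∫⁻ y in s, g y := by
        rw [lintegral_comp_affine _ _ ha0, lintegral_indicator hs]
    _ ≤ _ := by
        gcongr
        rw [ENNReal.inv_pow, ← ENNReal.ofReal_inv_of_pos ha0]
        gcongr
        rw [show (2 : ℝ≥0∞) = ENNReal.ofReal 2 by simp]
        refine ENNReal.ofReal_le_ofReal ?_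
        rw [inv_le_comm₀ ha0 two_pos]
        linarith

/-- Poincaré inequality for pairs of points in a ball. -/
theorem lintegral_lintegral_enorm_sub_rpow_le {p : ℝ} (hp : 1 ≤ p)
    {u : EuclideanSpace ℝ (Fin N) → ℝ} (hu : ContDiff ℝ 1 u)
    (x₀ : EuclideanSpace ℝ (Fin N)) (r : ℝ) :
    ∫⁻ x in ball x₀ r, ∫⁻ y in ball x₀ r, ‖u x - u y‖ₑ ^ p ≤
      ENNReal.ofReal (2 * r) ^ p * 2 ^ N * volume (ball x₀ r) *
        ∫⁻ x in ball x₀ r, ‖fderiv ℝ u x‖ₑ ^ p := by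
  have hp0 : 0 < p := by linarith
  set B := ball x₀ r with hB
  set g : EuclideanSpace ℝ (Fin N) → ℝ≥0∞ := fun x => ‖fderiv ℝ u x‖ₑ ^ p with hg
  have hgc : Continuous g := continuous_enorm_fderiv_rpow hu
  have hct : ENNReal.ofReal (2 * r) ^ p ≠ ⊤ :=
    ENNReal.rpow_ne_top_of_nonneg hp0.le ENNReal.ofReal_ne_top
  have key : ∀ t ∈ Icc (0 : ℝ) 1,
      ∫⁻ x in B, ∫⁻ y in B, g (y + t • (x - y)) ≤ 2 ^ N * volume B * ∫⁻ y in B, g y := by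
    intro t ht
    -- In `t x + (1 - t) y` one coefficient is at least `1 / 2`. Integrating over that variable
    -- first keeps the Jacobian away from zero, uniformly in `t`.
    rcases le_total (1 / 2) t with h | h
    · rw [lintegral_lintegral_swap]
      · calc ∫⁻ y in B, ∫⁻ x in B, g (y + t • (x - y))
            ≤ ∫⁻ y in B, (2 ^ N * ∫⁻ y in B, g y) := by
              refine setLIntegral_mono' measurableSet_ball fun y hy => ?_
              refine le_trans (le_of_eq ?_) (setLIntegral_comp_combo_le measurableSet_ball
                (convex_ball x₀ r) g hy h ht.2)
              refine lintegral_congr fun x => ?_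
              congr 1
              module
          _ = _ := by rw [setLIntegral_const]; ring
      · exact (hgc.comp (by fun_prop :
          Continuous fun q : _ × _ => q.2 + t • (q.1 - q.2))).measurable.aemeasurable
    · calc ∫⁻ x in B, ∫⁻ y in B, g (y + t • (x - y))
          ≤ ∫⁻ x in B, (2 ^ N * ∫⁻ y in B, g y) := by
            refine setLIntegral_mono' measurableSet_ball fun x hx => ?_
            refine le_trans (le_of_eq ?_) (setLIntegral_comp_combo_le measurableSet_ball
              (convex_ball x₀ r) g hx (a := 1 - t) (by linarith) (by linarith [ht.1]))
            refine lintegral_congr fun y => ?_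
            congr 1
            module
        _ = _ := by rw [setLIntegral_const]; ring
  calc ∫⁻ x in B, ∫⁻ y in B, ‖u x - u y‖ₑ ^ p
      ≤ ∫⁻ x in B, ∫⁻ y in B, ENNReal.ofReal (2 * r) ^ p *
          ∫⁻ t in Icc (0 : ℝ) 1, g (y + t • (x - y)) := by
        refine setLIntegral_mono' measurableSet_ball fun x hx => ?_
        refine setLIntegral_mono' measurableSet_ball fun y hy => ?_
        refine (enorm_sub_rpow_le hp hu x y).trans ?_
        gcongr
        rw [← ofReal_norm, ← dist_eq_norm]
        refine ENNReal.ofReal_le_ofReal ?_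
        have := dist_triangle_right x y x₀
        rw [hB, mem_ball] at hx hy
        linarith
    _ = ENNReal.ofReal (2 * r) ^ p *
          ∫⁻ t in Icc (0 : ℝ) 1, ∫⁻ x in B, ∫⁻ y in B, g (y + t • (x - y)) := by
        simp_rw [lintegral_const_mul' _ _ hct]
        congr 1
        symm
        rw [lintegral_lintegral_swap]
        · refine lintegral_congr fun x => ?_
          rw [lintegral_lintegral_swap]
          exact (hgc.comp (by fun_prop :
            Continuous fun q : ℝ × _ => q.2 + q.1 • (x - q.2))).measurable.aemeasurable
        · refine Measurable.aemeasurable ?_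
          have : Measurable fun q : (ℝ × EuclideanSpace ℝ (Fin N)) × EuclideanSpace ℝ (Fin N) =>
              g (q.2 + q.1.1 • (q.1.2 - q.2)) :=
            (hgc.comp (by fun_prop)).measurable
          exact this.lintegral_prod_right'
    _ ≤ ENNReal.ofReal (2 * r) ^ p *
          ∫⁻ _ in Icc (0 : ℝ) 1, 2 ^ N * volume B * ∫⁻ y in B, g y := by
        exact mul_le_mul_right (setLIntegral_mono' measurableSet_Icc key) _
    _ = _ := by
        rw [setLIntegral_const]
        simp only [Real.volume_Icc, sub_zero, ENNReal.ofReal_one, mul_one]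
        ring

theorem lintegral_setLIntegral_ball {f : EuclideanSpace ℝ (Fin N) → ℝ≥0∞} (hf : Measurable f)
    (r : ℝ) :
    ∫⁻ y, ∫⁻ x in ball y r, f x =
      volume (ball (0 : EuclideanSpace ℝ (Fin N)) r) * ∫⁻ x, f x := by
  have h1 : ∀ y, ∫⁻ x in ball y r, f x = ∫⁻ x, (ball x r).indicator (fun _ => f x) y := by
    intro y
    rw [← lintegral_indicator measurableSet_ball]
    refine lintegral_congr fun x => ?_
    simp only [indicator, mem_ball, dist_comm x y]
  simp_rw [h1]
  rw [lintegral_lintegral_swap]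
  · simp_rw [lintegral_indicator measurableSet_ball, setLIntegral_const,
      Measure.addHaar_ball_center]
    rw [lintegral_mul_const _ hf, mul_comm]
  · refine Measurable.aemeasurable ?_
    have hs : MeasurableSet {q : EuclideanSpace ℝ (Fin N) × EuclideanSpace ℝ (Fin N) |
        dist q.1 q.2 < r} := measurableSet_lt (by fun_prop) measurable_const
    convert (hf.comp measurable_snd).indicator hs using 1
    ext q
    simp [indicator, Function.uncurry]

/-- A local Poincaré inequality on all balls of a fixed radius gives a global one. -/
theorem le_poincareConst_of_local {p : ℝ} (hp : 0 < p) {Ω : Set (EuclideanSpace ℝ (Fin N))}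
    {a : ℝ≥0∞} (ha : a ≠ ⊤) {r : ℝ} (hr : 0 < r)
    (h : ∀ u, IsTest Ω u → ∀ y, a * ∫⁻ x in ball y r, ‖u x‖ₑ ^ p ≤
      ∫⁻ x in ball y r, ‖fderiv ℝ u x‖ₑ ^ p) : a ≤ poincareConst p Ω := by
  refine le_poincareConst hp fun u hu => ?_
  have h0 : volume (ball (0 : EuclideanSpace ℝ (Fin N)) r) ≠ 0 := (measure_ball_pos _ _ hr).ne'
  have ht : volume (ball (0 : EuclideanSpace ℝ (Fin N)) r) ≠ ⊤ := measure_ball_lt_top.ne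
  -- After integration over all centres, each side is the volume of a ball times a global integral;
  -- no covering argument is needed.
  rw [← ENNReal.mul_le_mul_iff_right h0 ht, energy, ← lintegral_setLIntegral_ball
    (continuous_enorm_fderiv_rpow hu.contDiff_one).measurable, mul_left_comm,
    ← lintegral_setLIntegral_ball
    (continuous_enorm_rpow hu.1.continuous).measurable,
    ← lintegral_const_mul' _ _ ha]
  exact lintegral_mono fun y => h u hu y

/-- The Poincaré constant of a set of small measure is large. -/
theorem le_poincareConst_of_volume_le {p : ℝ} (hp : 1 ≤ p) {Ω : Set (EuclideanSpace ℝ (Fin N))}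
    (hΩ : MeasurableSet Ω) {s : ℝ} (hs : 0 < s)
    (h : volume Ω ≤ volume (ball (0 : EuclideanSpace ℝ (Fin N)) s) / 2) :
    (2 * (ENNReal.ofReal (2 * s) ^ p * 2 ^ N))⁻¹ ≤ poincareConst p Ω := by
  have hp0 : 0 < p := by linarith
  set A := ENNReal.ofReal (2 * s) ^ p * 2 ^ N with hA
  have hA0 : A ≠ 0 := mul_ne_zero
    (ENNReal.rpow_pos (by simp [hs]) ENNReal.ofReal_ne_top).ne' (by simp)
  have hAt : A ≠ ⊤ := ENNReal.mul_ne_top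
    (ENNReal.rpow_ne_top_of_nonneg hp0.le ENNReal.ofReal_ne_top) (by simp)
  refine le_poincareConst_of_local hp0 (ENNReal.inv_ne_top.2 (mul_ne_zero two_ne_zero hA0)) hs
    fun u hu y => ?_
  rw [mul_comm, ← div_eq_mul_inv]
  refine ENNReal.div_le_of_le_mul ?_
  set W := volume (ball (0 : EuclideanSpace ℝ (Fin N)) s) with hW
  have hW0 : W ≠ 0 := (measure_ball_pos _ _ hs).ne'
  have hWt : W ≠ ⊤ := measure_ball_lt_top.ne
  have h1 := lintegral_lintegral_enorm_sub_rpow_le hp hu.contDiff_one y s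
  rw [Measure.addHaar_ball_center, ← hA, ← hW] at h1
  -- At least half of every ball of radius `s` lies outside `Ω`. There `u` vanishes, so differences
  -- `u x - u z` control `u x` itself.
  have h2 : W / 2 ≤ volume (ball y s \ Ω) := by
    have h3 := le_measure_sdiff (μ := volume) (s₁ := ball y s) (s₂ := Ω)
    rw [Measure.addHaar_ball_center, ← hW] at h3
    refine le_trans ?_ h3
    calc W / 2 = W - W / 2 := (ENNReal.sub_half hWt).symm
      _ ≤ W - volume Ω := tsub_le_tsub_left h _
  have h4 : (∫⁻ x in ball y s, ‖u x‖ₑ ^ p) * (W / 2) ≤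
      ∫⁻ x in ball y s, ∫⁻ z in ball y s, ‖u x - u z‖ₑ ^ p := by
    rw [← lintegral_mul_const _
      (continuous_enorm_rpow hu.1.continuous).measurable]
    refine lintegral_mono fun x => ?_
    calc ‖u x‖ₑ ^ p * (W / 2) ≤ ‖u x‖ₑ ^ p * volume (ball y s \ Ω) := by gcongr
      _ = ∫⁻ z in ball y s \ Ω, ‖u x‖ₑ ^ p := by rw [setLIntegral_const]
      _ = ∫⁻ z in ball y s \ Ω, ‖u x - u z‖ₑ ^ p := by
        refine setLIntegral_congr_fun (measurableSet_ball.diff hΩ) fun z hz => ?_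
        have : u z = 0 := by
          by_contra h0
          exact hz.2 (hu.2.2 (subset_tsupport _ h0))
        simp [this]
      _ ≤ _ := lintegral_mono_set sdiff_subset
  rw [← ENNReal.mul_le_mul_iff_left (ENNReal.div_ne_zero.2 ⟨hW0, ENNReal.ofNat_ne_top⟩)
    (ENNReal.div_ne_top hWt two_ne_zero)]
  refine (h4.trans h1).trans (le_of_eq ?_)
  conv_lhs => rw [← ENNReal.mul_div_cancel two_ne_zero ENNReal.ofNat_ne_top (b := W)]
  ring

/-! ### Cutoffs, finiteness and positivity of the capacity of balls -/

/-- Smooth cutoffs between concentric balls, with a gradient bound uniform in the centre. -/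
theorem exists_cutoff (N : ℕ) {a b : ℝ} (ha : 0 < a) (hab : a < b) :
    ∃ L : ℝ≥0∞, L ≠ ⊤ ∧ ∀ y : EuclideanSpace ℝ (Fin N), ∃ η : EuclideanSpace ℝ (Fin N) → ℝ,
      IsTest (ball y b) η ∧ (∀ x, 0 ≤ η x) ∧ (∀ x, η x ≤ 1) ∧ (∀ x ∈ closedBall y a, η x = 1) ∧
      ∀ x, ‖fderiv ℝ η x‖ₑ ≤ L := by
  let f : ContDiffBump (0 : EuclideanSpace ℝ (Fin N)) :=
    ⟨a, (a + b) / 2, ha, by linarith⟩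
  have hf : IsTest (ball (0 : EuclideanSpace ℝ (Fin N)) b) f := by
    refine ⟨f.contDiff, f.hasCompactSupport, ?_⟩
    rw [f.tsupport_eq]
    exact closedBall_subset_ball (by change (a + b) / 2 < b; linarith)
  obtain ⟨C, hC⟩ := (f.hasCompactSupport.fderiv ℝ).exists_bound_of_continuous
    (hf.contDiff_one.continuous_fderiv (by simp))
  refine ⟨ENNReal.ofReal C, ENNReal.ofReal_ne_top, fun y => ⟨fun x => f (-y + x), ?_,
    fun x => f.nonneg, fun x => f.le_one, fun x hx => ?_, fun x => ?_⟩⟩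
  · have := hf.comp_affine (-y) one_pos
    simp only [one_smul] at this
    convert this using 1
    ext x
    simp [dist_eq_norm, sub_eq_add_neg, add_comm]
  · refine f.one_of_mem_closedBall ?_
    rw [mem_closedBall, dist_eq_norm] at hx ⊢
    simpa [sub_eq_add_neg, add_comm] using hx
  · rw [fderiv_comp_add_left, ← ofReal_norm]
    exact ENNReal.ofReal_le_ofReal (hC _)

theorem enorm_clm_add_le (A B : EuclideanSpace ℝ (Fin N) →L[ℝ] ℝ) :
    ‖A + B‖ₑ ≤ ‖A‖ₑ + ‖B‖ₑ :=
  ENNReal.coe_le_coe.2 (nnnorm_add_le A B)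

theorem enorm_fderiv_mul_le {η f : EuclideanSpace ℝ (Fin N) → ℝ} {x : EuclideanSpace ℝ (Fin N)}
    (hη : DifferentiableAt ℝ η x) (hf : DifferentiableAt ℝ f x) :
    ‖fderiv ℝ (fun x => η x * f x) x‖ₑ ≤
      ‖fderiv ℝ η x‖ₑ * ‖f x‖ₑ + ‖η x‖ₑ * ‖fderiv ℝ f x‖ₑ := by
  have h := fderiv_fun_mul hη hf
  rw [h, add_comm, mul_comm ‖fderiv ℝ η x‖ₑ, ← enorm_smul, ← enorm_smul]
  exact enorm_clm_add_le _ _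

theorem energy_mul_le {p : ℝ} (hp : 1 ≤ p) {E : Set (EuclideanSpace ℝ (Fin N))}
    (hE : MeasurableSet E)
    {η f : EuclideanSpace ℝ (Fin N) → ℝ} (hη : IsTest E η) (hη0 : ∀ x, 0 ≤ η x)
    (hη1 : ∀ x, η x ≤ 1) {L : ℝ≥0∞} (hL : L ≠ ⊤) (hηL : ∀ x, ‖fderiv ℝ η x‖ₑ ≤ L)
    (hf : ContDiff ℝ ∞ f) :
    energy p (fun x => η x * f x) ≤
      2 ^ (p - 1) * (L ^ p * (∫⁻ x in E, ‖f x‖ₑ ^ p) + ∫⁻ x in E, ‖fderiv ℝ f x‖ₑ ^ p) := by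
  have hp0 : 0 < p := by linarith
  have hLp : L ^ p ≠ ⊤ := ENNReal.rpow_ne_top_of_nonneg hp0.le hL
  have h2 : (2 : ℝ≥0∞) ^ (p - 1) ≠ ⊤ :=
    ENNReal.rpow_ne_top_of_nonneg (by linarith) ENNReal.ofNat_ne_top
  rw [← setLIntegral_fderiv_eq_energy hp0 (hη.mul_contDiff hf).2.2,
    ← lintegral_const_mul' _ _ hLp, ← lintegral_add_left
      ((continuous_enorm_rpow hf.continuous).measurable.const_mul _),
    ← lintegral_const_mul' _ _ h2]
  refine setLIntegral_mono' hE fun x _ => ?_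
  refine le_trans ?_ ((ENNReal.rpow_add_le_mul_rpow_add_rpow (L * ‖f x‖ₑ) (‖fderiv ℝ f x‖ₑ)
    hp).trans_eq (by rw [ENNReal.mul_rpow_of_nonneg _ _ hp0.le]))
  refine ENNReal.rpow_le_rpow ?_ hp0.le
  refine (enorm_fderiv_mul_le (hη.differentiable x) (hf.differentiable (by simp) x)).trans ?_
  have : ‖η x‖ₑ ≤ 1 := by
    rw [Real.enorm_eq_ofReal (hη0 x)]
    exact ENNReal.ofReal_le_one.2 (hη1 x)
  calc _ ≤ L * ‖f x‖ₑ + 1 * ‖fderiv ℝ f x‖ₑ := by gcongr; exact hηL x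
    _ = _ := by rw [one_mul]

theorem relCap_closedBall_lt_top {p : ℝ} (hp : 1 ≤ p) {a b : ℝ} (ha : 0 < a) (hab : a < b)
    (y : EuclideanSpace ℝ (Fin N)) : relCap p (closedBall y a) (ball y b) < ⊤ := by
  have hp0 : 0 < p := by linarith
  obtain ⟨L, hL, h⟩ := exists_cutoff N ha hab
  obtain ⟨η, h1, -, -, h4, h5⟩ := h y
  refine (relCap_le hp0 h1 (fun x hx => (h4 x hx).ge)).trans_lt ?_
  rw [← setLIntegral_fderiv_eq_energy hp0 h1.2.2]
  calc _ ≤ ∫⁻ x in ball y b, L ^ p :=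
        lintegral_mono fun x => ENNReal.rpow_le_rpow (h5 x) hp0.le
    _ = L ^ p * volume (ball y b) := by rw [setLIntegral_const]
    _ < ⊤ := ENNReal.mul_lt_top (ENNReal.rpow_lt_top_of_nonneg hp0.le hL) measure_ball_lt_top

theorem volume_ball_eq (y : EuclideanSpace ℝ (Fin N)) {r : ℝ} (hr : 0 < r) :
    volume (ball y r) = ENNReal.ofReal r ^ N *
      volume (ball (0 : EuclideanSpace ℝ (Fin N)) 1) := by
  rw [Measure.addHaar_ball_of_pos _ _ hr, finrank_euclideanSpace_fin, ENNReal.ofReal_pow hr.le]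

/-- A competitor has `p`-th power integral at least the volume of the unit ball, and `poincareConst`
of `ball 0 2` is positive: this ball fills at most half of the volume of `ball 0 4`, since `N ≥ 1`.
-/
theorem relCap_unit_closedBall_pos {p : ℝ} (hN : 1 ≤ N) (hp : 1 ≤ p) :
    0 < relCap p (closedBall (0 : EuclideanSpace ℝ (Fin N)) 1) (ball 0 2) := by
  have hp0 : 0 < p := by linarith
  have h1 : volume (ball (0 : EuclideanSpace ℝ (Fin N)) 2) ≤
      volume (ball (0 : EuclideanSpace ℝ (Fin N)) 4) / 2 := by
    rw [ENNReal.le_div_iff_mul_le (by simp) (by simp), volume_ball_eq _ two_pos,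
      volume_ball_eq _ four_pos, show (4 : ℝ) = 2 * 2 by norm_num,
      ENNReal.ofReal_mul two_pos.le, mul_pow, ENNReal.ofReal_ofNat, mul_right_comm]
    gcongr
    calc (2 : ℝ≥0∞) = 2 ^ 1 := (pow_one 2).symm
      _ ≤ 2 ^ N := pow_le_pow_right₀ (by norm_num) hN
  have h2 := le_poincareConst_of_volume_le hp measurableSet_ball four_pos h1
  set κ := (2 * (ENNReal.ofReal (2 * 4) ^ p * 2 ^ N))⁻¹
  have hκ : κ ≠ 0 := by
    refine ENNReal.inv_ne_zero.2 (ENNReal.mul_ne_top (by simp) (ENNReal.mul_ne_top ?_ (by simp)))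
    exact ENNReal.rpow_ne_top_of_nonneg hp0.le ENNReal.ofReal_ne_top
  refine lt_of_lt_of_le (ENNReal.mul_pos hκ (measure_ball_pos volume
    (0 : EuclideanSpace ℝ (Fin N)) one_pos).ne') (le_relCap hp0 fun φ h3 h4 => ?_)
  refine le_trans ?_ (poincareConst_mul_le hp0 h3)
  refine mul_le_mul' h2 ?_
  calc volume (ball (0 : EuclideanSpace ℝ (Fin N)) 1)
      = ∫⁻ x in ball (0 : EuclideanSpace ℝ (Fin N)) 1, 1 := by simp
    _ ≤ ∫⁻ x in ball (0 : EuclideanSpace ℝ (Fin N)) 1, ‖φ x‖ₑ ^ p := by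
      refine setLIntegral_mono' measurableSet_ball fun x hx => ?_
      refine ENNReal.one_le_rpow ?_ hp0
      have := h4 x (ball_subset_closedBall hx)
      rw [Real.enorm_eq_ofReal (by linarith)]
      simpa using this
    _ ≤ _ := setLIntegral_le_lintegral _ _

theorem relCap_translate {p : ℝ} (hp : 0 < p) (y : EuclideanSpace ℝ (Fin N)) :
    relCap p (closedBall y 1) (ball y (2 * 1)) =
      relCap p (closedBall (0 : EuclideanSpace ℝ (Fin N)) 1) (ball 0 2) := by
  have h := relCap_preimage_affine hp (closedBall (y + (1 : ℝ) • 0) (1 * 1))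
    (ball (y + (1 : ℝ) • 0) (1 * 2)) y one_pos
  rw [preimage_affine_closedBall _ _ one_pos, preimage_affine_ball _ _ one_pos] at h
  simpa using h.symm

/-! ### The lower bound at unit scale -/

/-- The local Poincaré inequality in terms of the capacity of the zero set. -/
theorem exists_local_poincare (hN : 1 ≤ N) {p : ℝ} (hp : 1 ≤ p) :
    ∃ M : ℝ≥0∞, M ≠ 0 ∧ M ≠ ⊤ ∧ ∀ γ : ℝ, γ < 1 →
      ∀ (Ω : Set (EuclideanSpace ℝ (Fin N))) (y : EuclideanSpace ℝ (Fin N)),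
      ¬ IsNegligible p γ y 1 (closedBall y 1 \ Ω) → ∀ u, IsTest Ω u →
      ENNReal.ofReal γ * ∫⁻ x in ball y 2, ‖u x‖ₑ ^ p ≤
        M * ∫⁻ x in ball y 2, ‖fderiv ℝ u x‖ₑ ^ p := by
  have hp0 : 0 < p := by linarith
  obtain ⟨L, hL, hcut⟩ := exists_cutoff N one_pos one_lt_two
  set c := relCap p (closedBall (0 : EuclideanSpace ℝ (Fin N)) 1) (ball 0 2) with hc
  have hc0 : c ≠ 0 := (relCap_unit_closedBall_pos hN hp).ne'
  have hct : c ≠ ⊤ := (relCap_closedBall_lt_top hp one_pos one_lt_two _).ne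
  set W := volume (ball (0 : EuclideanSpace ℝ (Fin N)) 2) with hW
  have hW0 : W ≠ 0 := (measure_ball_pos _ _ two_pos).ne'
  have hWt : W ≠ ⊤ := measure_ball_lt_top.ne
  set A := ENNReal.ofReal (2 * 2) ^ p * 2 ^ N with hA
  have hA0 : A ≠ 0 := mul_ne_zero (ENNReal.rpow_pos (by simp) ENNReal.ofReal_ne_top).ne' (by simp)
  have hAt : A ≠ ⊤ := ENNReal.mul_ne_top
    (ENNReal.rpow_ne_top_of_nonneg hp0.le ENNReal.ofReal_ne_top) (by simp)
  have h2t : (2 : ℝ≥0∞) ^ (p - 1) ≠ ⊤ :=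
    ENNReal.rpow_ne_top_of_nonneg (by linarith) ENNReal.ofNat_ne_top
  have h20 : (2 : ℝ≥0∞) ^ (p - 1) ≠ 0 := (ENNReal.rpow_pos (by simp) ENNReal.ofNat_ne_top).ne'
  have hLp : L ^ p ≠ ⊤ := ENNReal.rpow_ne_top_of_nonneg hp0.le hL
  set D := (2 : ℝ≥0∞) ^ (p - 1) * (L ^ p * A + 1) with hD
  have hDt : D ≠ ⊤ := ENNReal.mul_ne_top h2t
    (ENNReal.add_ne_top.2 ⟨ENNReal.mul_ne_top hLp hAt, ENNReal.one_ne_top⟩)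
  -- `A` bounds the oscillation of `u` about `m`, `D` the energy of `η (m - u)`, and `W` is the
  -- volume over which `|m|^p` is integrated.
  refine ⟨2 ^ (p - 1) * (A + c⁻¹ * D * W), mul_ne_zero h20 (by simp [hA0]),
    ENNReal.mul_ne_top h2t (ENNReal.add_ne_top.2 ⟨hAt, ENNReal.mul_ne_top (ENNReal.mul_ne_top
      (ENNReal.inv_ne_top.2 hc0) hDt) hWt⟩), fun γ hγ Ω y hneg u hu => ?_⟩
  set G := ∫⁻ x in ball y 2, ‖fderiv ℝ u x‖ₑ ^ p with hG
  have hyW : volume (ball y 2) = W := Measure.addHaar_ball_center _ _ _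
  -- A point value `u z` serves in place of the mean: some `z` does no worse than the average over
  -- `z` of the double integral.
  obtain ⟨z, -, hz⟩ : ∃ z ∈ ball y 2, ∫⁻ x in ball y 2, ‖u x - u z‖ₑ ^ p ≤ A * G := by
    have h1 := lintegral_lintegral_enorm_sub_rpow_le hp hu.contDiff_one y 2
    obtain ⟨z, hz, h2⟩ := exists_le_setLAverage (μ := volume) (s := ball y 2)
      (f := fun z => ∫⁻ x in ball y 2, ‖u z - u x‖ₑ ^ p) (by rw [hyW]; exact hW0)
      (by rw [hyW]; exact hWt) (by
        refine Measurable.aemeasurable ?_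
        have : Measurable fun q : EuclideanSpace ℝ (Fin N) × EuclideanSpace ℝ (Fin N) =>
            ‖u q.1 - u q.2‖ₑ ^ p :=
          (ENNReal.continuous_rpow_const.comp ((hu.1.continuous.comp continuous_fst).sub
            (hu.1.continuous.comp continuous_snd)).enorm).measurable
        exact this.lintegral_prod_right')
    refine ⟨z, hz, ?_⟩
    simp_rw [← enorm_neg (u z - u _), neg_sub] at h2
    refine h2.trans ?_
    rw [setLAverage_eq, hyW]
    refine ENNReal.div_le_of_le_mul ?_
    rw [← hA, hyW] at h1
    simp_rw [← enorm_neg (u _ - u _), neg_sub] at h1 ⊢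
    exact h1.trans (le_of_eq (by ring))
  set m := u z
  have hm : ENNReal.ofReal γ * ‖m‖ₑ ^ p ≤ c⁻¹ * D * G := by
    obtain ⟨η, h1, h2, h3, h4, h5⟩ := hcut y
    have hf : ContDiff ℝ ∞ fun x => m - u x := contDiff_const.sub hu.1
    -- Outside `Ω` the function `u` vanishes, so `η (m - u) = m` there on the unit ball.
    have h6 := relCap_mul_le (K := closedBall y 1 \ Ω) hp0 (h1.mul_contDiff hf) (m := m)
      fun x hx => by
        have : u x = 0 := by
          by_contra h0
          exact hx.2 (hu.2.2 (subset_tsupport _ h0))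
        rw [h4 x hx.1, this]; ring
    have h7 := energy_mul_le hp measurableSet_ball h1 h2 h3 hL h5 hf
    have h8 : ∀ x, ‖fderiv ℝ (fun x => m - u x) x‖ₑ = ‖fderiv ℝ u x‖ₑ := fun x => by
      rw [fderiv_const_sub, enorm_neg]
    have h9 : ∀ x, ‖m - u x‖ₑ = ‖u x - m‖ₑ := fun x => by rw [← enorm_neg, neg_sub]
    simp_rw [h8, h9] at h7
    have h10 : ENNReal.ofReal γ * c ≤ relCap p (closedBall y 1 \ Ω) (ball y 2) := by
      rw [IsNegligible, not_le, relCap_translate hp0, mul_one] at hneg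
      exact hneg.le
    have h11 : ENNReal.ofReal γ * c * ‖m‖ₑ ^ p ≤ D * G := by
      calc _ ≤ _ := mul_le_mul_left h10 _
        _ ≤ _ := h6
        _ ≤ _ := h7
        _ ≤ 2 ^ (p - 1) * (L ^ p * (A * G) + G) := by gcongr
        _ = _ := by rw [hD]; ring
    calc ENNReal.ofReal γ * ‖m‖ₑ ^ p = c⁻¹ * c * (ENNReal.ofReal γ * ‖m‖ₑ ^ p) := by
          rw [ENNReal.inv_mul_cancel hc0 hct, one_mul]
      _ = c⁻¹ * (ENNReal.ofReal γ * c * ‖m‖ₑ ^ p) := by ring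
      _ ≤ c⁻¹ * (D * G) := by gcongr
      _ = _ := by ring
  have hsplit : ∫⁻ x in ball y 2, ‖u x‖ₑ ^ p ≤ 2 ^ (p - 1) * (A * G + ‖m‖ₑ ^ p * W) := by
    calc ∫⁻ x in ball y 2, ‖u x‖ₑ ^ p
        ≤ ∫⁻ x in ball y 2, 2 ^ (p - 1) * (‖u x - m‖ₑ ^ p + ‖m‖ₑ ^ p) := by
          refine lintegral_mono fun x => ?_
          refine le_trans (ENNReal.rpow_le_rpow ?_ hp0.le)
            (ENNReal.rpow_add_le_mul_rpow_add_rpow _ _ hp)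
          simpa using enorm_add_le (u x - m) m
      _ = 2 ^ (p - 1) * ((∫⁻ x in ball y 2, ‖u x - m‖ₑ ^ p) + ‖m‖ₑ ^ p * W) := by
          rw [lintegral_const_mul' _ _ h2t, lintegral_add_right _ measurable_const,
            setLIntegral_const, hyW]
      _ ≤ _ := by gcongr
  calc ENNReal.ofReal γ * ∫⁻ x in ball y 2, ‖u x‖ₑ ^ p
      ≤ ENNReal.ofReal γ * (2 ^ (p - 1) * (A * G + ‖m‖ₑ ^ p * W)) := by gcongr
    _ = 2 ^ (p - 1) * (ENNReal.ofReal γ * (A * G) + (ENNReal.ofReal γ * ‖m‖ₑ ^ p) * W) := by ring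
    _ ≤ 2 ^ (p - 1) * (1 * (A * G) + (c⁻¹ * D * G) * W) := by
        gcongr
        exact ENNReal.ofReal_le_one.2 hγ.le
    _ = _ := by ring

theorem exists_lower_const (hN : 1 ≤ N) {p : ℝ} (hp : 1 ≤ p) :
    ∃ κ : ℝ≥0∞, κ ≠ 0 ∧ κ ≠ ⊤ ∧ ∀ γ : ℝ, γ < 1 → ∀ (Ω : Set (EuclideanSpace ℝ (Fin N))),
      (∀ y, ¬ IsNegligible p γ y 1 (closedBall y 1 \ Ω)) →
      ENNReal.ofReal γ * κ ≤ poincareConst p Ω := by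
  obtain ⟨M, hM0, hMt, h⟩ := exists_local_poincare hN hp
  refine ⟨M⁻¹, ENNReal.inv_ne_zero.2 hMt, ENNReal.inv_ne_top.2 hM0, fun γ hγ Ω hΩ => ?_⟩
  refine le_poincareConst_of_local (by linarith) (ENNReal.mul_ne_top ENNReal.ofReal_ne_top
    (ENNReal.inv_ne_top.2 hM0)) two_pos fun u hu y => ?_
  have h1 := h γ hγ Ω y (hΩ y) u hu
  rw [mul_right_comm, ← div_eq_mul_inv]
  exact (ENNReal.div_le_of_le_mul' h1)

/-! ### Normalized competitors and left continuity of the capacity -/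

/-- A smooth truncation of the real line to `[0, 1]` whose slope is almost at most one. -/
theorem exists_smooth_truncation {ε : ℝ} (hε : 0 < ε) :
    ∃ h : ℝ → ℝ, ContDiff ℝ ∞ h ∧ (∃ δ > 0, (∀ t ≤ δ, h t = 0) ∧ ∀ t ≥ 1 - δ, h t = 1) ∧
      (∀ t, 0 ≤ h t) ∧ (∀ t, h t ≤ 1) ∧ ∀ t, |deriv h t| ≤ 1 + ε := by
  -- The truncation is the normalized primitive of a bump supported in `[δ, 1 - δ]` and equal to one
  -- on `[2δ, 1 - 2δ]`. Its slope is at most `1 / (1 - 4δ)`.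
  obtain ⟨δ, hδ, hδ8, hδε⟩ : ∃ δ > 0, δ < 1 / 8 ∧ 1 ≤ (1 - 4 * δ) * (1 + ε) := by
    refine ⟨min (1 / 16) (ε / (4 * (1 + ε))), by positivity, ?_, ?_⟩
    · exact (min_le_left _ _).trans_lt (by norm_num)
    · have h1 := min_le_right (1 / 16) (ε / (4 * (1 + ε)))
      rw [le_div_iff₀ (by positivity)] at h1
      nlinarith
  let f : ContDiffBump (1 / 2 : ℝ) := ⟨1 / 2 - 2 * δ, 1 / 2 - δ, by linarith, by linarith⟩
  have hfc : Continuous f := f.continuous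
  have hf0 : ∀ t ≤ δ, f t = 0 := fun t ht => f.zero_of_le_dist (by
    change 1 / 2 - δ ≤ _
    rw [Real.dist_eq, abs_of_nonpos] <;> linarith)
  have hf1 : ∀ t ≥ 1 - δ, f t = 0 := fun t ht => f.zero_of_le_dist (by
    change 1 / 2 - δ ≤ _
    rw [Real.dist_eq, abs_of_nonneg] <;> linarith)
  have hfin : ∀ t ∈ Icc (2 * δ) (1 - 2 * δ), f t = 1 := fun t ht => f.one_of_mem_closedBall (by
    rw [mem_closedBall, Real.dist_eq, abs_le]
    change -(1 / 2 - 2 * δ) ≤ _ ∧ _ ≤ 1 / 2 - 2 * δ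
    constructor <;> linarith [ht.1, ht.2])
  have hint : ∀ a b : ℝ, IntervalIntegrable f volume a b := fun a b => hfc.intervalIntegrable a b
  set I := ∫ x in (0 : ℝ)..1, f x with hI
  have hI1 : 1 - 4 * δ ≤ I := by
    have e : ∫ x in (2 * δ)..(1 - 2 * δ), f x = 1 - 4 * δ := by
      rw [intervalIntegral.integral_congr (g := fun _ => (1 : ℝ))]
      · simp; ring
      · intro t ht
        rw [uIcc_of_le (by linarith)] at ht
        exact hfin t ht
    rw [← e]
    exact intervalIntegral.integral_mono_interval (by linarith) (by linarith) (by linarith)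
      (ae_of_all _ fun x => f.nonneg) (hint _ _)
  have hI0 : 0 < I := by linarith
  set h : ℝ → ℝ := fun t => (∫ x in (0 : ℝ)..t, f x) / I with hh
  have hd : ∀ t, HasDerivAt h (f t / I) t := fun t =>
    (intervalIntegral.integral_hasDerivAt_right (hint 0 t)
      hfc.stronglyMeasurable.stronglyMeasurableAtFilter hfc.continuousAt).div_const I
  have hderiv : deriv h = fun t => f t / I := funext fun t => (hd t).deriv
  have hmono : Monotone h := monotone_of_deriv_nonneg (fun t => (hd t).differentiableAt)
    fun t => by rw [hderiv]; exact div_nonneg f.nonneg hI0.le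
  have h0 : ∀ t ≤ δ, h t = 0 := fun t ht => by
    have : ∫ x in (0 : ℝ)..t, f x = ∫ x in (0 : ℝ)..t, (0 : ℝ) :=
      intervalIntegral.integral_congr fun x hx => by
        refine hf0 x ?_
        have : max 0 t ≤ δ := max_le hδ.le ht
        exact hx.2.trans this
    rw [hh]; simp [this]
  have h1 : ∀ t ≥ 1 - δ, h t = 1 := fun t ht => by
    have : ∫ x in (1 : ℝ)..t, f x = ∫ x in (1 : ℝ)..t, (0 : ℝ) :=
      intervalIntegral.integral_congr fun x hx => by
        refine hf1 x ?_
        have : 1 - δ ≤ min 1 t := le_min (by linarith) ht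
        exact this.trans hx.1
    have h2 := intervalIntegral.integral_add_adjacent_intervals (hint 0 1) (hint 1 t)
    rw [this] at h2
    simp only [intervalIntegral.integral_zero, add_zero] at h2
    rw [hh]
    simp only [← h2]
    exact div_self hI0.ne'
  refine ⟨h, ?_, ⟨δ, hδ, h0, h1⟩, fun t => ?_, fun t => ?_, fun t => ?_⟩
  · rw [contDiff_infty_iff_deriv, hderiv]
    exact ⟨fun t => (hd t).differentiableAt, f.contDiff.div_const I⟩
  · rw [← h0 (min t δ) (min_le_right _ _)]
    exact hmono (min_le_left _ _)
  · rw [← h1 (max t (1 - δ)) (le_max_right _ _)]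
    exact hmono (le_max_left _ _)
  · rw [hderiv, abs_of_nonneg (div_nonneg f.nonneg hI0.le), div_le_iff₀ hI0]
    have : f t ≤ 1 := f.le_one
    nlinarith

theorem exists_pos_ofReal_rpow_mul_lt {e a : ℝ≥0∞} (h : e < a) (q : ℝ) :
    ∃ ε : ℝ, 0 < ε ∧ ENNReal.ofReal (1 + ε) ^ q * e < a := by
  have h1 : Tendsto (fun ε : ℝ => ENNReal.ofReal (1 + ε) ^ q * e) (𝓝[>] 0) (𝓝 (1 * e)) := by
    refine ENNReal.Tendsto.mul_const ?_ (Or.inl one_ne_zero)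
    have h2 : Tendsto (fun ε : ℝ => ENNReal.ofReal (1 + ε) ^ q) (𝓝 0)
        (𝓝 (ENNReal.ofReal (1 + 0) ^ q)) :=
      ((ENNReal.continuous_rpow_const.comp
        (ENNReal.continuous_ofReal.comp (continuous_const.add continuous_id))).tendsto (0 : ℝ))
    simp only [add_zero, ENNReal.ofReal_one, ENNReal.one_rpow] at h2
    exact h2.mono_left nhdsWithin_le_nhds
  rw [one_mul] at h1
  obtain ⟨ε, h3, h4⟩ := ((h1.eventually_lt_const h).and self_mem_nhdsWithin).exists
  exact ⟨ε, h4, h3⟩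

/-- Competitors for the capacity may be taken with values in `[0, 1]` and equal to one near the
set. -/
theorem exists_normalized_of_relCap_lt {p : ℝ} (hp : 0 < p)
    {K E : Set (EuclideanSpace ℝ (Fin N))} {a : ℝ≥0∞} (h : relCap p K E < a) :
    ∃ φ, IsTest E φ ∧ (∀ x, 0 ≤ φ x) ∧ (∀ x, φ x ≤ 1) ∧
      (∃ U, IsOpen U ∧ K ⊆ U ∧ ∀ x ∈ U, φ x = 1) ∧ energy p φ < a := by
  obtain ⟨φ, h1, h2, h3⟩ := exists_of_relCap_lt hp h
  obtain ⟨ε, hε, h4⟩ := exists_pos_ofReal_rpow_mul_lt h3 p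
  obtain ⟨g, hg, ⟨δ, hδ, hg0, hg1⟩, hnn, hle, hgd⟩ := exists_smooth_truncation hε
  have hg00 : g 0 = 0 := hg0 0 hδ.le
  -- As `g` reaches one already at `1 - δ`, the composite is one on the open set `{φ > 1 - δ}`,
  -- which contains `K`. The factor `(1 + ε) ^ p` fits into the strict inequality.
  refine ⟨g ∘ φ, ⟨hg.comp h1.1, h1.2.1.comp_left hg00,
    (tsupport_comp_subset hg00 φ).trans h1.2.2⟩, fun x => hnn _, fun x => hle _,
    ⟨{x | 1 - δ < φ x}, isOpen_lt continuous_const h1.1.continuous, fun x hx => ?_,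
      fun x hx => hg1 _ (le_of_lt hx)⟩, lt_of_le_of_lt ?_ h4⟩
  · have := h2 x hx
    change 1 - δ < φ x
    linarith
  · have hc : ENNReal.ofReal (1 + ε) ^ p ≠ ⊤ :=
      ENNReal.rpow_ne_top_of_nonneg hp.le ENNReal.ofReal_ne_top
    unfold energy
    rw [← lintegral_const_mul' _ _ hc]
    refine lintegral_mono fun x => ?_
    have h5 : HasFDerivAt (g ∘ φ) (deriv g (φ x) • fderiv ℝ φ x) x :=
      ((hg.differentiable (by simp)) (φ x)).hasDerivAt.comp_hasFDerivAt x
        (h1.differentiable x).hasFDerivAt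
    rw [h5.fderiv, enorm_smul, ENNReal.mul_rpow_of_nonneg _ _ hp.le]
    gcongr
    rw [← ofReal_norm]
    exact ENNReal.ofReal_le_ofReal (hgd _)

/-- Change of variables: the chain rule costs `b ^ p` and the Jacobian one more factor `b`.
Surjectivity is not needed, since the integral over the image is bounded by the full one. -/
theorem energy_comp_le_of_injective {p : ℝ} (hp : 0 < p)
    {F : EuclideanSpace ℝ (Fin N) → EuclideanSpace ℝ (Fin N)}
    {F' : EuclideanSpace ℝ (Fin N) → EuclideanSpace ℝ (Fin N) →L[ℝ] EuclideanSpace ℝ (Fin N)}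
    (hF : ∀ x, HasFDerivAt F (F' x) x) (hinj : Function.Injective F) {b : ℝ}
    (hnorm : ∀ x, ‖F' x‖ ≤ b) (hdet : ∀ x, 1 ≤ b * |(F' x).det|)
    {φ : EuclideanSpace ℝ (Fin N) → ℝ} (hφ : Differentiable ℝ φ) :
    energy p (φ ∘ F) ≤ ENNReal.ofReal b ^ (p + 1) * energy p φ := by
  have hb : 0 ≤ b := (norm_nonneg _).trans (hnorm 0)
  have hbt : ENNReal.ofReal b ^ (p + 1) ≠ ⊤ :=
    ENNReal.rpow_ne_top_of_nonneg (by linarith) ENNReal.ofReal_ne_top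
  have hcv := lintegral_image_eq_lintegral_abs_det_fderiv_mul volume MeasurableSet.univ
    (fun x _ => (hF x).hasFDerivWithinAt) hinj.injOn (fun x => ‖fderiv ℝ φ x‖ₑ ^ p)
  rw [Measure.restrict_univ] at hcv
  calc energy p (φ ∘ F)
      ≤ ∫⁻ x, ENNReal.ofReal b ^ (p + 1) *
          (ENNReal.ofReal |(F' x).det| * ‖fderiv ℝ φ (F x)‖ₑ ^ p) := by
        refine lintegral_mono fun x => ?_
        have h1 : ‖fderiv ℝ (φ ∘ F) x‖ₑ ≤ ENNReal.ofReal b * ‖fderiv ℝ φ (F x)‖ₑ := by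
          rw [((hφ (F x)).hasFDerivAt.comp x (hF x)).fderiv, ← ofReal_norm, ← ofReal_norm,
            ← ENNReal.ofReal_mul hb]
          refine ENNReal.ofReal_le_ofReal ((ContinuousLinearMap.opNorm_comp_le _ _).trans ?_)
          rw [mul_comm]
          gcongr
          exact hnorm x
        calc ‖fderiv ℝ (φ ∘ F) x‖ₑ ^ p ≤ (ENNReal.ofReal b * ‖fderiv ℝ φ (F x)‖ₑ) ^ p := by gcongr
          _ = ENNReal.ofReal b ^ p * (1 * ‖fderiv ℝ φ (F x)‖ₑ ^ p) := by
            rw [ENNReal.mul_rpow_of_nonneg _ _ hp.le, one_mul]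
          _ ≤ ENNReal.ofReal b ^ p * ((ENNReal.ofReal b * ENNReal.ofReal |(F' x).det|) *
              ‖fderiv ℝ φ (F x)‖ₑ ^ p) := by
            gcongr
            rw [← ENNReal.ofReal_mul hb, ENNReal.one_le_ofReal]
            exact hdet x
          _ = _ := by
            rw [ENNReal.rpow_add_of_nonneg _ _ hp.le zero_le_one, ENNReal.rpow_one]
            ring
    _ = ENNReal.ofReal b ^ (p + 1) * ∫⁻ x in F '' univ, ‖fderiv ℝ φ x‖ₑ ^ p := by
        rw [lintegral_const_mul' _ _ hbt, hcv]
    _ ≤ _ := by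
        gcongr
        exact setLIntegral_le_lintegral _ _

/-- Left continuity of the capacity of concentric balls. -/
theorem exists_lt_relCap_closedBall {p : ℝ} (hp : 0 < p) {a : ℝ≥0∞}
    (ha : a < relCap p (closedBall (0 : EuclideanSpace ℝ (Fin N)) 1) (ball 0 2)) :
    ∃ s : ℝ, 0 < s ∧ s < 1 ∧
      a < relCap p (closedBall (0 : EuclideanSpace ℝ (Fin N)) s) (ball 0 2) := by
  obtain ⟨δ, hδ, hδa⟩ := exists_pos_ofReal_rpow_mul_lt ha (p + 1)
  let χ : ContDiffBump (0 : EuclideanSpace ℝ (Fin N)) := ⟨1, 3 / 2, one_pos, by norm_num⟩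
  set G : EuclideanSpace ℝ (Fin N) → EuclideanSpace ℝ (Fin N) := fun x => χ x • x with hG
  have hGs : ContDiff ℝ ∞ G := χ.contDiff.smul contDiff_id
  have hGc : HasCompactSupport G := χ.hasCompactSupport.smul_right
  obtain ⟨L, hL⟩ := (hGc.fderiv ℝ).exists_bound_of_continuous
    (hGs.continuous_fderiv (by simp))
  have hL0 : 0 ≤ L := (norm_nonneg _).trans (hL 0)
  obtain ⟨ρ, hρ, hdet⟩ : ∃ ρ > 0, ∀ A : EuclideanSpace ℝ (Fin N) →L[ℝ] EuclideanSpace ℝ (Fin N),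
      dist A (ContinuousLinearMap.id ℝ _) < ρ → (1 + δ)⁻¹ < |A.det| := by
    have h1 : Continuous fun A : EuclideanSpace ℝ (Fin N) →L[ℝ] EuclideanSpace ℝ (Fin N) =>
        |A.det| := ContinuousLinearMap.continuous_det.abs
    have h2 : (1 + δ)⁻¹ < |(ContinuousLinearMap.id ℝ (EuclideanSpace ℝ (Fin N))).det| := by
      have : (ContinuousLinearMap.id ℝ (EuclideanSpace ℝ (Fin N))).det = 1 := by
        simp [ContinuousLinearMap.det]
      rw [this, abs_one]
      exact inv_lt_one_of_one_lt₀ (by linarith)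
    have h3 := (h1.tendsto (ContinuousLinearMap.id ℝ _)).eventually_const_lt h2
    obtain ⟨ρ, hρ, h4⟩ := Metric.eventually_nhds_iff.1 h3
    exact ⟨ρ, hρ, fun A hA => h4 hA⟩
  obtain ⟨θ, hθ, hθ1, hθδ, hθρ, hθL⟩ : ∃ θ > 0, θ < 1 ∧ θ * L ≤ δ ∧ θ * L < ρ ∧ θ * L < 1 := by
    have h1 : Tendsto (fun θ : ℝ => θ * L) (𝓝[>] 0) (𝓝 0) := by
      have : Tendsto (fun θ : ℝ => θ * L) (𝓝 0) (𝓝 (0 * L)) :=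
        (continuous_id.mul continuous_const).tendsto 0
      rw [zero_mul] at this
      exact this.mono_left nhdsWithin_le_nhds
    obtain ⟨θ, ⟨⟨⟨h2, h3⟩, h4⟩, h5⟩, h6⟩ := ((((h1.eventually_lt_const hδ).and
      (h1.eventually_lt_const hρ)).and (h1.eventually_lt_const one_pos)).and
      ((tendsto_id.mono_left nhdsWithin_le_nhds).eventually_lt_const
        (one_pos : (0 : ℝ) < 1))).and self_mem_nhdsWithin |>.exists
    exact ⟨θ, h6, h5, h2.le, h3, h4⟩
  -- `F` shrinks the closed unit ball by the factor `1 - θ` and is the identity far out. So `φ ∘ F`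
  -- competes for the unit ball whenever `φ` competes for the smaller one, and for small `θ` the map
  -- is close to the identity in `C^1`.
  set F : EuclideanSpace ℝ (Fin N) → EuclideanSpace ℝ (Fin N) := fun x => x - θ • G x with hFdef
  set F' : EuclideanSpace ℝ (Fin N) → EuclideanSpace ℝ (Fin N) →L[ℝ] EuclideanSpace ℝ (Fin N) :=
    fun x => ContinuousLinearMap.id ℝ _ - θ • fderiv ℝ G x with hF'
  have hFs : ContDiff ℝ ∞ F := contDiff_id.sub (hGs.const_smul θ)
  have hF : ∀ x, HasFDerivAt F (F' x) x := fun x =>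
    (hasFDerivAt_id x).sub (((hGs.differentiable (by simp)) x).hasFDerivAt.const_smul θ)
  have hθG : ∀ x, ‖θ • fderiv ℝ G x‖ ≤ θ * L := fun x => by
    rw [norm_smul, Real.norm_eq_abs, abs_of_pos hθ]
    gcongr
    exact hL x
  have hnorm : ∀ x, ‖F' x‖ ≤ 1 + δ := fun x =>
    (norm_sub_le _ _).trans (add_le_add ContinuousLinearMap.norm_id_le ((hθG x).trans hθδ))
  have hdet' : ∀ x, 1 ≤ (1 + δ) * |(F' x).det| := fun x => by
    have h1 := hdet (F' x) (by
      rw [dist_eq_norm, hF', sub_sub_cancel_left, norm_neg]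
      exact (hθG x).trans_lt hθρ)
    have h2 : 0 < 1 + δ := by linarith
    calc (1 : ℝ) = (1 + δ) * (1 + δ)⁻¹ := (mul_inv_cancel₀ h2.ne').symm
      _ ≤ _ := by gcongr
  -- `θ • G` has Lipschitz constant `θ * L < 1`.
  have hinj : Function.Injective F := by
    intro x y hxy
    by_contra hne
    have h1 : ‖G x - G y‖ ≤ L * ‖x - y‖ :=
      convex_univ.norm_image_sub_le_of_norm_fderiv_le
        (fun z _ => (hGs.differentiable (by simp)) z) (fun z _ => hL z) (mem_univ y) (mem_univ x)
    have h2 : x - y = θ • (G x - G y) := by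
      have h3 : x - θ • G x = y - θ • G y := hxy
      rw [smul_sub, sub_eq_sub_iff_add_eq_add]
      rw [sub_eq_sub_iff_add_eq_add] at h3
      rw [h3]; abel
    have h3 : 0 < ‖x - y‖ := norm_pos_iff.2 (sub_ne_zero.2 hne)
    have h4 : ‖x - y‖ = θ * ‖G x - G y‖ := by
      conv_lhs => rw [h2, norm_smul, Real.norm_eq_abs, abs_of_pos hθ]
    nlinarith
  have hFout : ∀ x, 2 ≤ ‖x‖ → F x = x := fun x hx => by
    have : χ x = 0 := χ.zero_of_le_dist (by
      change 3 / 2 ≤ _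
      rw [dist_zero_right]; linarith)
    simp [hFdef, hG, this]
  refine ⟨1 - θ, by linarith, by linarith, ?_⟩
  have hmain : relCap p (closedBall (0 : EuclideanSpace ℝ (Fin N)) 1) (ball 0 2) ≤
      ENNReal.ofReal (1 + δ) ^ (p + 1) *
        relCap p (closedBall (0 : EuclideanSpace ℝ (Fin N)) (1 - θ)) (ball 0 2) := by
    have hb0 : ENNReal.ofReal (1 + δ) ^ (p + 1) ≠ 0 :=
      (ENNReal.rpow_pos (ENNReal.ofReal_pos.2 (by linarith)) ENNReal.ofReal_ne_top).ne'
    have hbt : ENNReal.ofReal (1 + δ) ^ (p + 1) ≠ ⊤ :=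
      ENNReal.rpow_ne_top_of_nonneg (by linarith) ENNReal.ofReal_ne_top
    rw [mul_comm, ← ENNReal.div_le_iff hb0 hbt]
    refine le_relCap hp fun φ h1 h2 => ?_
    rw [ENNReal.div_le_iff hb0 hbt, mul_comm]
    have hsupp : tsupport (φ ∘ F) ⊆ ball 0 2 := fun x hx => by
      have h3 : F x ∈ ball (0 : EuclideanSpace ℝ (Fin N)) 2 :=
        h1.2.2 (tsupport_comp_subset_preimage φ hFs.continuous hx)
      by_contra h4
      have h5 : 2 ≤ ‖x‖ := by simpa using h4
      rw [hFout x h5] at h3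
      exact h4 h3
    have hT : IsTest (ball 0 2) (φ ∘ F) := ⟨h1.1.comp hFs,
      HasCompactSupport.of_support_subset_isCompact (isCompact_closedBall 0 2)
        ((subset_tsupport _).trans (hsupp.trans ball_subset_closedBall)), hsupp⟩
    refine (relCap_le hp hT fun x hx => h2 _ ?_).trans
      (energy_comp_le_of_injective hp hF hinj hnorm hdet' h1.differentiable)
    have h6 : F x = (1 - θ) • x := by
      have : χ x = 1 := χ.one_of_mem_closedBall hx
      simp [hFdef, hG, this, sub_smul]
    rw [mem_closedBall_zero_iff] at hx ⊢
    rw [h6, norm_smul, Real.norm_eq_abs, abs_of_pos (by linarith)]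
    nlinarith
  exact lt_of_mul_lt_mul_left' (hδa.trans_le hmain)

/-! ### The upper bound at unit scale -/

theorem enorm_fderiv_const_sub (a : ℝ) (u : EuclideanSpace ℝ (Fin N) → ℝ)
    (x : EuclideanSpace ℝ (Fin N)) :
    ‖fderiv ℝ (fun x => a - u x) x‖ₑ = ‖fderiv ℝ u x‖ₑ := by
  rw [fderiv_const_sub, enorm_neg]

/-- Raising `u` to one on the set where a cutoff `ψ` equals one increases the energy by at most a
multiple of the `L^p` distance of `u` to one on the support of `ψ`. -/
theorem energy_rpow_le_add {p : ℝ} (hp : 1 ≤ p) {s' : ℝ} {E : Set (EuclideanSpace ℝ (Fin N))}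
    {u ψ : EuclideanSpace ℝ (Fin N) → ℝ} (hu : IsTest E u) (hψ : IsTest (ball 0 s') ψ)
    (hψ0 : ∀ x, 0 ≤ ψ x) (hψ1 : ∀ x, ψ x ≤ 1) {L : ℝ≥0∞} (hL : L ≠ ⊤)
    (hψL : ∀ x, ‖fderiv ℝ ψ x‖ₑ ≤ L) :
    energy p (fun x => u x + ψ x * (1 - u x)) ^ (1 / p) ≤
      energy p u ^ (1 / p) + L * (∫⁻ x in ball 0 s', ‖1 - u x‖ₑ ^ p) ^ (1 / p) := by
  have hp0 : 0 < p := by linarith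
  have hLp : L ^ p ≠ ⊤ := ENNReal.rpow_ne_top_of_nonneg hp0.le hL
  have hpt : ∀ x, ‖fderiv ℝ (fun x => u x + ψ x * (1 - u x)) x‖ₑ ≤
      ((fun x => ‖fderiv ℝ u x‖ₑ) + fun x => ‖fderiv ℝ ψ x‖ₑ * ‖1 - u x‖ₑ) x := fun x => by
    -- In this form the product rule leaves the coefficient `1 - ψ ≤ 1` in front of `∇u`.
    have e : (fun x => u x + ψ x * (1 - u x)) = fun x => 1 - (1 - ψ x) * (1 - u x) := by
      ext x; ring
    rw [e, enorm_fderiv_const_sub 1 (fun x => (1 - ψ x) * (1 - u x))]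
    refine (enorm_fderiv_mul_le ((hψ.differentiable x).const_sub 1)
      ((hu.differentiable x).const_sub 1)).trans ?_
    rw [enorm_fderiv_const_sub, enorm_fderiv_const_sub, add_comm]
    refine add_le_add ?_ le_rfl
    have : ‖1 - ψ x‖ₑ ≤ 1 := by
      rw [Real.enorm_eq_ofReal (by linarith [hψ1 x])]
      exact ENNReal.ofReal_le_one.2 (by linarith [hψ0 x])
    exact mul_le_of_le_one_left' this
  have hm1 : Measurable fun x => ‖fderiv ℝ u x‖ₑ :=
    (hu.contDiff_one.continuous_fderiv (by simp)).enorm.measurable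
  have hm2 : Measurable fun x => ‖fderiv ℝ ψ x‖ₑ * ‖1 - u x‖ₑ :=
    (hψ.contDiff_one.continuous_fderiv (by simp)).enorm.measurable.mul
      (continuous_const.sub hu.1.continuous).enorm.measurable
  have h1 : ∫⁻ x, (‖fderiv ℝ ψ x‖ₑ * ‖1 - u x‖ₑ) ^ p ≤
      L ^ p * ∫⁻ x in ball 0 s', ‖1 - u x‖ₑ ^ p := by
    rw [← lintegral_const_mul' _ _ hLp, ← lintegral_indicator measurableSet_ball]
    refine lintegral_mono fun x => ?_
    by_cases hx : x ∈ ball 0 s'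
    · rw [indicator_of_mem hx, ← ENNReal.mul_rpow_of_nonneg _ _ hp0.le]
      gcongr
      exact hψL x
    · have : fderiv ℝ ψ x = 0 := by
        by_contra h0
        exact hx (hψ.2.2 (support_fderiv_subset ℝ h0))
      simp [← ofReal_norm, this, hp0]
  calc energy p (fun x => u x + ψ x * (1 - u x)) ^ (1 / p)
      ≤ (∫⁻ x, ((fun x => ‖fderiv ℝ u x‖ₑ) +
          fun x => ‖fderiv ℝ ψ x‖ₑ * ‖1 - u x‖ₑ) x ^ p) ^ (1 / p) := by
        refine ENNReal.rpow_le_rpow (lintegral_mono fun x => ?_) (by positivity)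
        exact ENNReal.rpow_le_rpow (hpt x) hp0.le
    _ ≤ _ := ENNReal.lintegral_Lp_add_le hm1.aemeasurable hm2.aemeasurable hp
    _ ≤ energy p u ^ (1 / p) + (L ^ p * ∫⁻ x in ball 0 s', ‖1 - u x‖ₑ ^ p) ^ (1 / p) := by
        gcongr
        rfl
    _ = _ := by
        rw [ENNReal.mul_rpow_of_nonneg _ _ (by positivity : 0 ≤ 1 / p), ← ENNReal.rpow_mul,
          mul_one_div_cancel hp0.ne', ENNReal.rpow_one]

/-- The test function is `η (1 - u)` with `u` a competitor for the removed set. Its norm is bounded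
below by a capacity gap, so the constant depends on `Ω` only through negligibility. -/
theorem exists_upper_const (hN : 1 ≤ N) {p : ℝ} (hp : 1 ≤ p) {γ : ℝ} (hγ : γ < 1) :
    ∃ C : ℝ≥0∞, C ≠ ⊤ ∧ ∀ Ω : Set (EuclideanSpace ℝ (Fin N)),
      IsNegligible p γ 0 1 (closedBall 0 1 \ Ω) → poincareConst p Ω ≤ C := by
  have hp0 : 0 < p := by linarith
  set c := relCap p (closedBall (0 : EuclideanSpace ℝ (Fin N)) 1) (ball 0 2) with hc
  have hc0 : c ≠ 0 := (relCap_unit_closedBall_pos hN hp).ne'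
  have hct : c ≠ ⊤ := (relCap_closedBall_lt_top hp one_pos one_lt_two _).ne
  have hγc : ENNReal.ofReal γ * c < c := by
    conv_rhs => rw [← one_mul c]
    exact ENNReal.mul_lt_mul_left hc0 hct (by simpa using hγ)
  obtain ⟨s, hs0, hs1, hs⟩ := exists_lt_relCap_closedBall hp0 hγc
  set b := relCap p (closedBall (0 : EuclideanSpace ℝ (Fin N)) s) (ball 0 2) with hb
  have hbt : b ≠ ⊤ := (relCap_closedBall_lt_top hp hs0 (by linarith) _).ne
  obtain ⟨a, ha1, ha2⟩ := exists_between hs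
  set s' := (s + 1) / 2 with hs'
  obtain ⟨L, hL, hcut⟩ := exists_cutoff N hs0 (show s < s' by rw [hs']; linarith)
  obtain ⟨L', hL', hcut'⟩ := exists_cutoff N (show 0 < s' by rw [hs']; linarith)
    (show s' < 1 by rw [hs']; linarith)
  obtain ⟨ψ, hψ, hψ0, hψ1, hψs, hψL⟩ := hcut 0
  obtain ⟨η, hη, hη0, hη1, hηs, hηL⟩ := hcut' 0
  -- The gap is measured after taking `p`-th roots because Minkowski's inequality has constant one
  -- in front of the energy of `u`; a factor `2 ^ (p - 1)` could destroy the gap.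
  set d := b ^ (1 / p) - a ^ (1 / p) with hd
  have hd0 : d ≠ 0 := by
    rw [hd, Ne, tsub_eq_zero_iff_le, not_le]
    exact ENNReal.rpow_lt_rpow ha2 (by positivity)
  have hdt : d ≠ ⊤ :=
    ENNReal.sub_ne_top (ENNReal.rpow_ne_top_of_nonneg (by positivity) hbt)
  have hdp0 : d ^ p ≠ 0 := (ENNReal.rpow_pos (pos_iff_ne_zero.2 hd0) hdt).ne'
  have hdpt : d ^ p ≠ ⊤ := ENNReal.rpow_ne_top_of_nonneg hp0.le hdt
  set W := volume (ball (0 : EuclideanSpace ℝ (Fin N)) 1) with hW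
  have hWt : W ≠ ⊤ := measure_ball_lt_top.ne
  have h2t : (2 : ℝ≥0∞) ^ (p - 1) ≠ ⊤ :=
    ENNReal.rpow_ne_top_of_nonneg (by linarith) ENNReal.ofNat_ne_top
  set D := (2 : ℝ≥0∞) ^ (p - 1) * (L' ^ p * W + a) with hD
  have hDt : D ≠ ⊤ := ENNReal.mul_ne_top h2t (ENNReal.add_ne_top.2 ⟨ENNReal.mul_ne_top
    (ENNReal.rpow_ne_top_of_nonneg hp0.le hL') hWt, (ha2.trans_le le_top).ne⟩)
  refine ⟨L ^ p * D / d ^ p, ENNReal.div_ne_top (ENNReal.mul_ne_top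
    (ENNReal.rpow_ne_top_of_nonneg hp0.le hL) hDt) hdp0, fun Ω hΩ => ?_⟩
  rw [IsNegligible, relCap_translate hp0, mul_one] at hΩ
  obtain ⟨u, hu, hu0, hu1, ⟨U, hUo, hKU, hU⟩, hue⟩ :=
    exists_normalized_of_relCap_lt hp0 (hΩ.trans_lt ha1)
  have hf : ContDiff ℝ ∞ fun x => 1 - u x := contDiff_const.sub hu.1
  have hfle : ∀ x, ‖1 - u x‖ₑ ≤ 1 := fun x => by
    rw [Real.enorm_eq_ofReal (by linarith [hu1 x])]
    exact ENNReal.ofReal_le_one.2 (by linarith [hu0 x])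
  set J := ∫⁻ x in ball 0 s', ‖1 - u x‖ₑ ^ p with hJ
  have hv : IsTest (ball 0 2) fun x => u x + ψ x * (1 - u x) :=
    hu.add ((hψ.mono (ball_subset_ball (by rw [hs']; linarith))).mul_contDiff hf)
  have hbv : b ≤ energy p fun x => u x + ψ x * (1 - u x) :=
    relCap_le hp0 hv fun x hx => by rw [hψs x hx]; linarith
  have hdJ : d ^ p ≤ L ^ p * J := by
    have h1 : d ≤ L * J ^ (1 / p) := by
      rw [hd, tsub_le_iff_left]
      calc b ^ (1 / p) ≤ _ := ENNReal.rpow_le_rpow hbv (by positivity)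
        _ ≤ _ := energy_rpow_le_add hp hu hψ hψ0 hψ1 hL hψL
        _ ≤ _ := by gcongr
    calc d ^ p ≤ (L * J ^ (1 / p)) ^ p := by gcongr
      _ = _ := by rw [ENNReal.mul_rpow_of_nonneg _ _ hp0.le, ← ENNReal.rpow_mul,
        one_div_mul_cancel hp0.ne', ENNReal.rpow_one]
  -- Here `u` must equal one on a neighbourhood of the removed set: this keeps the closed support of
  -- `1 - u` away from it.
  have hφ : IsTest Ω fun x => η x * (1 - u x) := by
    have h1 := hη.mul_contDiff hf
    refine ⟨h1.1, h1.2.1, fun x hx => ?_⟩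
    by_contra hxΩ
    have hxU : x ∈ U := hKU ⟨ball_subset_closedBall (h1.2.2 hx), hxΩ⟩
    refine (notMem_tsupport_iff_eventuallyEq.2 ?_) hx
    filter_upwards [hUo.mem_nhds hxU] with z hz
    simp [hU z hz]
  have hJφ : J ≤ ∫⁻ x, ‖η x * (1 - u x)‖ₑ ^ p := by
    calc J = ∫⁻ x in ball 0 s', ‖η x * (1 - u x)‖ₑ ^ p := by
          refine setLIntegral_congr_fun measurableSet_ball fun x hx => ?_
          simp only [hηs x (ball_subset_closedBall hx), one_mul]
      _ ≤ _ := setLIntegral_le_lintegral _ _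
  have hφD : energy p (fun x => η x * (1 - u x)) ≤ D := by
    refine (energy_mul_le hp measurableSet_ball hη hη0 hη1 hL' hηL hf).trans ?_
    simp_rw [enorm_fderiv_const_sub]
    rw [hD]
    refine mul_le_mul_right (add_le_add (mul_le_mul_right ?_ _) ?_) _
    · calc _ ≤ ∫⁻ x in ball (0 : EuclideanSpace ℝ (Fin N)) 1, 1 :=
            lintegral_mono fun x => ENNReal.rpow_le_one (hfle x) hp0.le
        _ = W := by simp [hW]
    · exact (setLIntegral_le_lintegral _ _).trans hue.le
  rw [ENNReal.le_div_iff_mul_le (Or.inl hdp0) (Or.inl hdpt)]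
  calc poincareConst p Ω * d ^ p ≤ poincareConst p Ω * (L ^ p * J) := by gcongr
    _ = L ^ p * (poincareConst p Ω * J) := by ring
    _ ≤ L ^ p * (poincareConst p Ω * ∫⁻ x, ‖η x * (1 - u x)‖ₑ ^ p) := by gcongr
    _ ≤ L ^ p * D := mul_le_mul_right ((poincareConst_mul_le hp0 hφ).trans hφD) _

/-! ### Strict monotonicity of the capacity of balls, and thin shells -/

/-- By scaling, the right side is `ρ ^ (p - N) > 1` times the capacity of `closedBall 0 ρ` in `ball
0 (2ρ)`, and enlarging the outer ball to `ball 0 2` does not increase that capacity. -/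
theorem relCap_closedBall_lt_of_lt {p : ℝ} (hN : 1 ≤ N) (hp : 1 ≤ p) (hpN : p < N) {ρ : ℝ}
    (hρ0 : 0 < ρ) (hρ1 : ρ < 1) :
    relCap p (closedBall (0 : EuclideanSpace ℝ (Fin N)) ρ) (ball 0 2) <
      relCap p (closedBall (0 : EuclideanSpace ℝ (Fin N)) 1) (ball 0 2) := by
  have hp0 : 0 < p := by linarith
  have h := relCap_preimage_affine hp0 (closedBall ((0 : EuclideanSpace ℝ (Fin N)) + ρ • 0) (ρ * 1))
    (ball (0 + ρ • 0) (ρ * 2)) 0 hρ0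
  rw [preimage_affine_closedBall _ _ hρ0, preimage_affine_ball _ _ hρ0] at h
  simp only [smul_zero, add_zero, mul_one] at h
  have hc0 := relCap_unit_closedBall_pos hN hp
  have hX := relCap_closedBall_lt_top hp hρ0 (show ρ < ρ * 2 by linarith)
    (0 : EuclideanSpace ℝ (Fin N))
  rw [h] at hc0 ⊢
  set X := relCap p (closedBall (0 : EuclideanSpace ℝ (Fin N)) ρ) (ball 0 (ρ * 2)) with hXdef
  refine (relCap_mono hp0 subset_rfl (ball_subset_ball (by linarith))).trans_lt (b := X) ?_
  have hX0 : X ≠ 0 := fun h0 => by simp [h0] at hc0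
  conv_lhs => rw [← one_mul X]
  refine ENNReal.mul_lt_mul_left hX0 hX.ne ?_
  rw [← div_eq_mul_inv, ENNReal.lt_div_iff_mul_lt (Or.inr (by simp)) (Or.inl (by simp)), one_mul,
    ENNReal.ofReal_rpow_of_pos hρ0, ← ENNReal.ofReal_pow hρ0.le, ← Real.rpow_natCast]
  exact (ENNReal.ofReal_lt_ofReal_iff (by positivity)).2
    (Real.rpow_lt_rpow_of_exponent_gt hρ0 hρ1 hpN)

/-- Let `u` be nearly optimal for the unit ball and equal to one near it, and `v` a competitor for
`closedBall 0 ρ` inside `ball 0 1`. The gradients of `u` and `v` are never both nonzero, so `(1 - s)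
u + s v` has energy at most `(1 - s) ^ p energy u + s ^ p energy v`. As `p > 1`, the second term is
negligible against the gain of order `s` in the first. -/
theorem relCap_closedBall_lt_of_one_lt {p : ℝ} (hN : 1 ≤ N) (hp : 1 < p) {ρ : ℝ}
    (hρ0 : 0 < ρ) (hρ1 : ρ < 1) :
    relCap p (closedBall (0 : EuclideanSpace ℝ (Fin N)) ρ) (ball 0 2) <
      relCap p (closedBall (0 : EuclideanSpace ℝ (Fin N)) 1) (ball 0 2) := by
  have hp0 : 0 < p := by linarith
  have hc0 := relCap_unit_closedBall_pos hN hp.le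
  have hct := relCap_closedBall_lt_top hp.le one_pos one_lt_two (0 : EuclideanSpace ℝ (Fin N))
  obtain ⟨v, hv, hvρ, hvt⟩ := exists_of_relCap_lt hp0
    (relCap_closedBall_lt_top hp.le hρ0 hρ1 (0 : EuclideanSpace ℝ (Fin N)))
  set c := relCap p (closedBall (0 : EuclideanSpace ℝ (Fin N)) 1) (ball 0 2) with hc
  have ec : ENNReal.ofReal c.toReal = c := ENNReal.ofReal_toReal hct.ne
  have ed : ENNReal.ofReal (energy p v).toReal = energy p v := ENNReal.ofReal_toReal hvt.ne
  have hc0' : 0 < c.toReal := ENNReal.toReal_pos hc0.ne' hct.ne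
  have hd0' : 0 ≤ (energy p v).toReal := ENNReal.toReal_nonneg
  set c' := c.toReal
  set d := (energy p v).toReal
  obtain ⟨s, hs0, hs1, hsd⟩ : ∃ s : ℝ, 0 < s ∧ s < 1 ∧ s ^ (p - 1) * d < c' := by
    have h1 : Tendsto (fun s : ℝ => s ^ (p - 1) * d) (𝓝[>] 0) (𝓝 0) := by
      have h2 : Tendsto (fun s : ℝ => s ^ (p - 1) * d) (𝓝 0) (𝓝 (0 ^ (p - 1) * d)) :=
        ((Real.continuous_rpow_const (by linarith)).mul continuous_const).tendsto 0
      rw [Real.zero_rpow (by linarith), zero_mul] at h2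
      exact h2.mono_left nhdsWithin_le_nhds
    obtain ⟨s, ⟨h2, h3⟩, h4⟩ := ((h1.eventually_lt_const hc0').and
      ((tendsto_id.mono_left nhdsWithin_le_nhds).eventually_lt_const
        (one_pos : (0 : ℝ) < 1))).and self_mem_nhdsWithin |>.exists
    exact ⟨s, h4, h3, h2⟩
  set q := s ^ (p - 1) * d with hq
  have hq0 : 0 ≤ q := by positivity
  -- The tolerance for `u` is half of the gain `s * (c' - q)`, so `(1 - s) * e + s * q` stays below
  -- `c'`.
  set e := c' + s * (c' - q) / 2 with he
  have hse : 0 < s * (c' - q) := mul_pos hs0 (by linarith)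
  have hce : c < ENNReal.ofReal e := by
    rw [← ec]
    exact (ENNReal.ofReal_lt_ofReal_iff (by rw [he]; linarith)).2 (by rw [he]; linarith)
  obtain ⟨u, hu, -, -, ⟨U, hUo, hKU, hU⟩, hue⟩ := exists_normalized_of_relCap_lt hp0 hce
  have hw : IsTest (ball 0 2) fun x => (1 - s) * u x + s * v x :=
    (hu.const_mul (1 - s)).add ((hv.mono (ball_subset_ball one_le_two)).const_mul s)
  have hpt : ∀ x, ‖fderiv ℝ (fun x => (1 - s) * u x + s * v x) x‖ₑ ^ p ≤
      ENNReal.ofReal (1 - s) ^ p * ‖fderiv ℝ u x‖ₑ ^ p +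
        ENNReal.ofReal s ^ p * ‖fderiv ℝ v x‖ₑ ^ p := fun x => by
    have h1 : fderiv ℝ (fun x => (1 - s) * u x + s * v x) x =
        (1 - s) • fderiv ℝ u x + s • fderiv ℝ v x := by
      rw [fderiv_fun_add ((hu.differentiable x).const_mul _) ((hv.differentiable x).const_mul _),
        fderiv_const_mul (hu.differentiable x), fderiv_const_mul (hv.differentiable x)]
    rw [h1]
    by_cases hx : x ∈ closedBall 0 1
    · have h2 : fderiv ℝ u x = 0 := by
        have : u =ᶠ[𝓝 x] fun _ => 1 := by
          filter_upwards [hUo.mem_nhds (hKU hx)] with z hz using hU z hz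
        rw [this.fderiv_eq, fderiv_fun_const]
        rfl
      rw [h2, smul_zero, zero_add, enorm_smul, ENNReal.mul_rpow_of_nonneg _ _ hp0.le,
        Real.enorm_eq_ofReal hs0.le]
      exact le_add_self
    · have h2 : fderiv ℝ v x = 0 := by
        by_contra h0
        exact hx (ball_subset_closedBall (hv.2.2 (support_fderiv_subset ℝ h0)))
      rw [h2, smul_zero, add_zero, enorm_smul, ENNReal.mul_rpow_of_nonneg _ _ hp0.le,
        Real.enorm_eq_ofReal (by linarith)]
      exact le_self_add
  have hsp : ENNReal.ofReal s ^ p = ENNReal.ofReal s * ENNReal.ofReal (s ^ (p - 1)) := by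
    rw [ENNReal.ofReal_rpow_of_pos hs0, ← ENNReal.ofReal_mul hs0.le]
    congr 1
    conv_rhs => rw [← Real.rpow_one_add' hs0.le (by linarith), add_sub_cancel]
  calc relCap p (closedBall (0 : EuclideanSpace ℝ (Fin N)) ρ) (ball 0 2)
      ≤ energy p fun x => (1 - s) * u x + s * v x := by
        refine relCap_le hp0 hw fun x hx => ?_
        have h1 := hvρ x hx
        rw [hU x (hKU (closedBall_subset_closedBall hρ1.le hx))]
        nlinarith
    _ ≤ ENNReal.ofReal (1 - s) ^ p * energy p u + ENNReal.ofReal s ^ p * energy p v := by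
        unfold energy
        rw [← lintegral_const_mul' _ _
            (ENNReal.rpow_ne_top_of_nonneg hp0.le ENNReal.ofReal_ne_top),
          ← lintegral_const_mul' _ _
            (ENNReal.rpow_ne_top_of_nonneg hp0.le ENNReal.ofReal_ne_top),
          ← lintegral_add_left
            ((continuous_enorm_fderiv_rpow hu.contDiff_one).measurable.const_mul _)]
        exact lintegral_mono hpt
    _ ≤ ENNReal.ofReal (1 - s) * ENNReal.ofReal e + ENNReal.ofReal s * ENNReal.ofReal q := by
        refine add_le_add (mul_le_mul' ?_ hue.le) (le_of_eq ?_)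
        · exact ENNReal.rpow_le_self_of_le_one (ENNReal.ofReal_le_one.2 (by linarith)) hp.le
        · rw [hsp, ← ed, mul_assoc, ← ENNReal.ofReal_mul (by positivity)]
    _ = ENNReal.ofReal ((1 - s) * e + s * q) := by
        rw [← ENNReal.ofReal_mul (by linarith), ← ENNReal.ofReal_mul hs0.le,
          ← ENNReal.ofReal_add]
        · exact mul_nonneg (by linarith) (by rw [he]; linarith)
        · positivity
    _ < c := by
        rw [← ec]
        refine (ENNReal.ofReal_lt_ofReal_iff hc0').2 ?_
        rw [he]
        nlinarith

/-- The perturbation argument needs `p > 1` and the scaling argument `p < N`; since `N ≥ 2`, the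
latter covers `p = 1`. -/
theorem relCap_closedBall_lt {p : ℝ} (hN : 2 ≤ N) (hp : 1 ≤ p) {ρ : ℝ}
    (hρ0 : 0 < ρ) (hρ1 : ρ < 1) :
    relCap p (closedBall (0 : EuclideanSpace ℝ (Fin N)) ρ) (ball 0 2) <
      relCap p (closedBall (0 : EuclideanSpace ℝ (Fin N)) 1) (ball 0 2) := by
  rcases hp.eq_or_lt with rfl | h
  · exact relCap_closedBall_lt_of_lt (by omega) le_rfl (by exact_mod_cast hN) hρ0 hρ1
  · exact relCap_closedBall_lt_of_one_lt (by omega) h hρ0 hρ1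

theorem tendsto_volume_annulus (N : ℕ) :
    Tendsto (fun t : ℝ => volume (ball (0 : EuclideanSpace ℝ (Fin N)) (1 + t) \
      closedBall 0 (1 - t))) (𝓝[>] 0) (𝓝 0) := by
  set V := volume (ball (0 : EuclideanSpace ℝ (Fin N)) 1) with hV
  have hVt : V ≠ ⊤ := measure_ball_lt_top.ne
  have h1 : Tendsto (fun t : ℝ => ENNReal.ofReal (1 + t) ^ N * V - ENNReal.ofReal (1 - t) ^ N * V)
      (𝓝[>] 0) (𝓝 (1 * V - 1 * V)) := by
    have hsum : Tendsto (fun t : ℝ => ENNReal.ofReal (1 + t) ^ N) (𝓝[>] 0) (𝓝 1) := by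
      have : Continuous fun t : ℝ => ENNReal.ofReal (1 + t) ^ N :=
        (ENNReal.continuous_pow N).comp (ENNReal.continuous_ofReal.comp (by fun_prop))
      simpa using (this.tendsto 0).mono_left nhdsWithin_le_nhds
    have hdif : Tendsto (fun t : ℝ => ENNReal.ofReal (1 - t) ^ N) (𝓝[>] 0) (𝓝 1) := by
      have : Continuous fun t : ℝ => ENNReal.ofReal (1 - t) ^ N :=
        (ENNReal.continuous_pow N).comp (ENNReal.continuous_ofReal.comp (by fun_prop))
      simpa using (this.tendsto 0).mono_left nhdsWithin_le_nhds
    exact ENNReal.Tendsto.sub (ENNReal.Tendsto.mul_const hsum (Or.inl one_ne_zero))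
      (ENNReal.Tendsto.mul_const hdif (Or.inl one_ne_zero)) (Or.inl (by simpa using hVt))
  rw [tsub_self] at h1
  refine h1.congr' ?_
  have h01 : ∀ᶠ t : ℝ in 𝓝[>] 0, t < 1 :=
    (tendsto_id.mono_left nhdsWithin_le_nhds).eventually_lt_const one_pos
  filter_upwards [self_mem_nhdsWithin, h01] with t ht ht1
  have ht0 : 0 < t := ht
  rw [measure_sdiff (closedBall_subset_ball (by linarith))
    measurableSet_closedBall.nullMeasurableSet
    measure_closedBall_lt_top.ne, volume_ball_eq _ (by linarith),
    Measure.addHaar_closedBall _ _ (by linarith), finrank_euclideanSpace_fin,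
    ENNReal.ofReal_pow (by linarith)]

/-- There are open sets with arbitrarily large Poincaré constant whose complement has less
capacity in the unit ball than the unit ball itself. -/
theorem exists_isOpen_poincareConst_ge {p : ℝ} (hN : 2 ≤ N) (hp : 1 ≤ p) (M : ℝ) :
    ∃ Ω : Set (EuclideanSpace ℝ (Fin N)), IsOpen Ω ∧ ENNReal.ofReal M ≤ poincareConst p Ω ∧
      relCap p (closedBall 0 1 \ Ω) (ball 0 2) <
        relCap p (closedBall (0 : EuclideanSpace ℝ (Fin N)) 1) (ball 0 2) := by
  have hp0 : 0 < p := by linarith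
  obtain ⟨s, hs0, hs⟩ : ∃ s : ℝ, 0 < s ∧
      2 * (ENNReal.ofReal (2 * s) ^ p * 2 ^ N) < (ENNReal.ofReal M)⁻¹ := by
    have h1 : Tendsto (fun s : ℝ => 2 * (ENNReal.ofReal (2 * s) ^ p * 2 ^ N)) (𝓝[>] 0) (𝓝 0) := by
      have h2 : Continuous fun s : ℝ => 2 * (ENNReal.ofReal (2 * s) ^ p * 2 ^ N) :=
        (ENNReal.continuous_const_mul (by simp)).comp ((ENNReal.continuous_mul_const (by simp)).comp
          (ENNReal.continuous_rpow_const.comp (ENNReal.continuous_ofReal.comp (by fun_prop))))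
      have h3 := (h2.tendsto 0).mono_left (nhdsWithin_le_nhds (s := Ioi 0))
      simpa [hp0] using h3
    obtain ⟨s, h2, h3⟩ := ((h1.eventually_lt_const
      (ENNReal.inv_pos.2 ENNReal.ofReal_ne_top)).and self_mem_nhdsWithin).exists
    exact ⟨s, h3, h2⟩
  have hW : 0 < volume (ball (0 : EuclideanSpace ℝ (Fin N)) s) / 2 :=
    ENNReal.div_pos (measure_ball_pos _ _ hs0).ne' (by simp)
  have h01 : ∀ᶠ t : ℝ in 𝓝[>] 0, t < 1 :=
    (tendsto_id.mono_left nhdsWithin_le_nhds).eventually_lt_const one_pos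
  obtain ⟨t, ⟨h2, ht1⟩, ht⟩ := ((((tendsto_volume_annulus N).eventually_lt_const hW).and h01).and
    self_mem_nhdsWithin).exists
  have ht0 : 0 < t := ht
  -- The open shell extends beyond the unit sphere, so only `closedBall 0 (1 - t)` is left of the
  -- closed unit ball.
  refine ⟨ball 0 (1 + t) \ closedBall 0 (1 - t), isOpen_ball.sdiff isClosed_closedBall, ?_, ?_⟩
  · exact (ENNReal.le_inv_iff_le_inv.1 hs.le).trans (le_poincareConst_of_volume_le hp
      (measurableSet_ball.diff measurableSet_closedBall) hs0 h2.le)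
  · refine (relCap_mono hp0 (fun x hx => ?_) subset_rfl).trans_lt
      (relCap_closedBall_lt hN hp (ρ := 1 - t) (by linarith) (by linarith))
    by_contra h3
    exact hx.2 ⟨closedBall_subset_ball (by linarith) hx.1, h3⟩

/-! ### From unit scale to the capacitary inradius -/

/-- The lower bound for the Poincaré constant in terms of the capacitary inradius. -/
theorem exists_mul_inv_capInradius_le (hN : 1 ≤ N) {p : ℝ} (hp : 1 ≤ p) :
    ∃ σ : ℝ, 0 < σ ∧ ∀ γ : ℝ, 0 < γ → γ < 1 → ∀ Ω : Set (EuclideanSpace ℝ (Fin N)),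
      ENNReal.ofReal (σ * γ) * (capInradius p γ Ω)⁻¹ ^ p ≤ poincareConst p Ω := by
  have hp0 : 0 < p := by linarith
  obtain ⟨κ, hκ0, hκt, h⟩ := exists_lower_const hN hp
  refine ⟨κ.toReal, ENNReal.toReal_pos hκ0 hκt, fun γ hγ0 hγ1 Ω => ?_⟩
  rw [ENNReal.ofReal_mul ENNReal.toReal_nonneg, ENNReal.ofReal_toReal hκt,
    mul_comm κ]
  set a := ENNReal.ofReal γ * κ
  set R := capInradius p γ Ω with hR
  set l := poincareConst p Ω
  have ha0 : a ≠ 0 := mul_ne_zero (by simpa using hγ0) hκ0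
  have hat : a ≠ ⊤ := ENNReal.mul_ne_top ENNReal.ofReal_ne_top hκt
  -- Above the inradius no ball of radius `r` is negligible; after rescaling, the bound at unit
  -- scale applies.
  have key : ∀ r : ℝ, R < ENNReal.ofReal r → a ≤ l * ENNReal.ofReal r ^ p := by
    intro r hr
    have hr0 : 0 < r := ENNReal.ofReal_pos.1 (bot_le.trans_lt hr)
    have h1 : ∀ y, ¬ IsNegligible p γ y 1
        (closedBall y 1 \ (fun x : EuclideanSpace ℝ (Fin N) => 0 + r • x) ⁻¹' Ω) := by
      intro y hy
      rw [isNegligible_preimage_affine hp0 γ Ω 0 y hr0] at hy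
      refine absurd hr (not_lt.2 ?_)
      rw [hR, capInradius]
      exact le_iSup₂_of_le r ⟨hr0, _, hy⟩ le_rfl
    have h2 := (mul_le_mul_right (h γ hγ1 _ h1) _).trans
      (poincareConst_preimage_affine_le hp0 Ω 0 hr0)
    have hr1 : ENNReal.ofReal r ^ p ≠ 0 := by simp [hr0]
    have hr2 : ENNReal.ofReal r ^ p ≠ ⊤ := by simp [hp0.le]
    rw [mul_comm, ← div_eq_mul_inv, ENNReal.div_le_iff hr1 hr2] at h2
    exact h2
  rcases eq_or_ne R ⊤ with hRt | hRt
  · simp [hRt, hp0]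
  rcases eq_or_ne l ⊤ with hlt | hlt
  · rw [hlt]
    exact le_top
  have hl0 : l ≠ 0 := fun hl => by
    have h1 := key (R.toReal + 1) (by
      rw [ENNReal.lt_ofReal_iff_toReal_lt hRt]
      linarith)
    rw [hl, zero_mul] at h1
    exact ha0 (le_zero_iff.1 h1)
  rw [ENNReal.inv_rpow, ← div_eq_mul_inv]
  refine ENNReal.div_le_of_le_mul ?_
  rw [mul_comm, ← ENNReal.div_le_iff hl0 hlt, ← ENNReal.rpow_inv_le_iff hp0]
  -- The goal is now `(a / l) ^ p⁻¹ ≤ R`, obtained by letting `b` decrease to `R`.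
  refine le_of_forall_gt_imp_ge_of_dense fun b hb => ?_
  rcases eq_or_ne b ⊤ with rfl | hbt
  · exact le_top
  rw [ENNReal.rpow_inv_le_iff hp0, ENNReal.div_le_iff hl0 hlt, mul_comm,
    ← ENNReal.ofReal_toReal hbt]
  exact key b.toReal (by rwa [ENNReal.ofReal_toReal hbt])

/-- The upper bound for the Poincaré constant in terms of the capacitary inradius. -/
theorem exists_le_mul_inv_capInradius (hN : 1 ≤ N) {p : ℝ} (hp : 1 ≤ p) {γ : ℝ} (hγ : γ < 1) :
    ∃ C₀ : ℝ, ∀ C : ℝ, C₀ ≤ C → 0 < C → ∀ Ω : Set (EuclideanSpace ℝ (Fin N)),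
      poincareConst p Ω ≤ ENNReal.ofReal C * (capInradius p γ Ω)⁻¹ ^ p := by
  have hp0 : 0 < p := by linarith
  obtain ⟨C₁, hC₁, h⟩ := exists_upper_const hN hp hγ
  refine ⟨C₁.toReal, fun C hC hC0 Ω => ?_⟩
  have hc0 : ENNReal.ofReal C ≠ 0 := by simpa using hC0
  have hct : ENNReal.ofReal C ≠ ⊤ := ENNReal.ofReal_ne_top
  set l := poincareConst p Ω
  have key : ∀ r : ℝ, 0 < r → ∀ x₀, IsNegligible p γ x₀ r (closedBall x₀ r \ Ω) →
      ENNReal.ofReal r ^ p * l ≤ ENNReal.ofReal C := by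
    intro r hr x₀ hx₀
    have h1 := (isNegligible_preimage_affine hp0 γ Ω x₀ 0 hr).2 (by simpa using hx₀)
    have h2 := poincareConst_preimage_affine_le hp0 ((fun x => x₀ + r • x) ⁻¹' Ω)
      (-(r⁻¹ • x₀)) (inv_pos.2 hr)
    rw [preimage_affine_inverse _ _ hr, ENNReal.ofReal_inv_of_pos hr, ENNReal.inv_rpow,
      inv_inv] at h2
    exact h2.trans ((h _ h1).trans ((ENNReal.le_ofReal_iff_toReal_le hC₁ hC0.le).2 hC))
  -- The bound is turned into `R ≤ (C / l) ^ p⁻¹`, to be checked for each radius in the supremum.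
  -- Positivity and finiteness of `C` make the divisions legitimate even if `l` is `0` or `⊤`.
  rw [ENNReal.inv_rpow, ← div_eq_mul_inv,
    ENNReal.le_div_iff_mul_le (Or.inr hc0) (Or.inr hct), mul_comm,
    ← ENNReal.le_div_iff_mul_le (Or.inr hc0) (Or.inr hct), ← ENNReal.le_rpow_inv_iff hp0]
  refine iSup₂_le fun r hr => ?_
  obtain ⟨hr0, x₀, hx₀⟩ := hr
  rw [ENNReal.le_rpow_inv_iff hp0, ENNReal.le_div_iff_mul_le (Or.inr hc0) (Or.inr hct)]
  exact key r hr0 x₀ hx₀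

/-- Every family of admissible constants in the upper bound blows up as `γ` tends to one. -/
theorem tendsto_atTop_of_forall_poincareConst_le (hN : 2 ≤ N) {p : ℝ} (hp : 1 ≤ p) (C : ℝ → ℝ)
    (hC : ∀ γ : ℝ, 0 < γ → γ < 1 → ∀ Ω : Set (EuclideanSpace ℝ (Fin N)), IsOpen Ω →
      poincareConst p Ω ≤ ENNReal.ofReal (C γ) * (capInradius p γ Ω)⁻¹ ^ p) :
    Tendsto C (𝓝[<] 1) atTop := by
  have hp0 : 0 < p := by linarith
  refine tendsto_atTop.2 fun M₀ => ?_
  -- A positive `M` is needed to recover `M ≤ C γ` from the inequality between the values of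
  -- `ENNReal.ofReal`.
  set M := max M₀ 1
  obtain ⟨Ω, hΩ, hMΩ, hcap⟩ := exists_isOpen_poincareConst_ge (N := N) hN hp M
  set c := relCap p (closedBall (0 : EuclideanSpace ℝ (Fin N)) 1) (ball 0 2) with hc
  have h1 : Tendsto (fun γ : ℝ => ENNReal.ofReal γ * c) (𝓝[<] 1) (𝓝 c) := by
    have h2 : Tendsto (fun γ : ℝ => ENNReal.ofReal γ * c) (𝓝 1) (𝓝 (ENNReal.ofReal 1 * c)) :=
      ENNReal.Tendsto.mul_const (ENNReal.continuous_ofReal.tendsto 1) (Or.inl (by simp))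
    rw [ENNReal.ofReal_one, one_mul] at h2
    exact h2.mono_left nhdsWithin_le_nhds
  have h0 : ∀ᶠ γ : ℝ in 𝓝[<] 1, 0 < γ :=
    (tendsto_id.mono_left nhdsWithin_le_nhds).eventually_const_lt one_pos
  filter_upwards [h1.eventually_const_lt hcap, h0, self_mem_nhdsWithin] with γ h2 hγ0 hγ1
  -- For these `γ` the unit ball about the origin is negligible.
  have h3 : 1 ≤ capInradius p γ Ω := by
    refine le_iSup₂_of_le 1 ⟨one_pos, 0, ?_⟩ (by simp)
    rw [IsNegligible, relCap_translate hp0, mul_one]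
    exact h2.le
  have h4 : ENNReal.ofReal M ≤ ENNReal.ofReal (C γ) := by
    refine (hMΩ.trans (hC γ hγ0 hγ1 Ω hΩ)).trans ?_
    refine mul_le_of_le_one_right' (ENNReal.rpow_le_one (ENNReal.inv_le_one.2 h3) hp0.le)
  rw [ENNReal.ofReal_le_ofReal_iff'] at h4
  have h5 : M₀ ≤ M := le_max_left _ _
  have h6 : 1 ≤ M := le_max_right _ _
  rcases h4 with h4 | h4 <;> linarith

end CapInradius

theorem mainTheorem1 (N : ℕ) (hN : 2 ≤ N) (p : ℝ) (hp1 : 1 ≤ p) (hpN : p ≤ N) :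
    -- the two-sided estimate
    (∃ σ : ℝ, 0 < σ ∧ ∃ C : ℝ → ℝ,
      (∀ γ : ℝ, 0 < γ → γ < 1 → ∀ Ω : Set (EuclideanSpace ℝ (Fin N)), IsOpen Ω →
        ENNReal.ofReal (σ * γ) * (CapInradius.capInradius p γ Ω)⁻¹ ^ p
            ≤ CapInradius.poincareConst p Ω ∧
        CapInradius.poincareConst p Ω
            ≤ ENNReal.ofReal (C γ) * (CapInradius.capInradius p γ Ω)⁻¹ ^ p) ∧
      Tendsto C (𝓝[<] 1) atTop) ∧
    -- the blow-up of the upper constant is unavoidable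
    (∀ C : ℝ → ℝ,
      (∀ γ : ℝ, 0 < γ → γ < 1 → ∀ Ω : Set (EuclideanSpace ℝ (Fin N)), IsOpen Ω →
        CapInradius.poincareConst p Ω
            ≤ ENNReal.ofReal (C γ) * (CapInradius.capInradius p γ Ω)⁻¹ ^ p) →
      Tendsto C (𝓝[<] 1) atTop) ∧
    -- positivity of the Poincaré constant, and independence of `γ`
    (∀ Ω : Set (EuclideanSpace ℝ (Fin N)), IsOpen Ω →
      (∀ γ : ℝ, 0 < γ → γ < 1 →
        (0 < CapInradius.poincareConst p Ω ↔ CapInradius.capInradius p γ Ω < ⊤)) ∧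
      (∀ γ γ' : ℝ, 0 < γ → γ < 1 → 0 < γ' → γ' < 1 →
        (CapInradius.capInradius p γ Ω < ⊤ ↔ CapInradius.capInradius p γ' Ω < ⊤))) := by
  have hN1 : 1 ≤ N := by omega
  have hp0 : 0 < p := by linarith
  obtain ⟨σ, hσ, hlow⟩ := CapInradius.exists_mul_inv_capInradius_le hN1 hp1
  choose! C₀ hC₀ using fun (γ : ℝ) (hγ : γ < 1) =>
    CapInradius.exists_le_mul_inv_capInradius hN1 hp1 hγ
  have hup : ∀ γ : ℝ, γ < 1 → ∀ Ω : Set (EuclideanSpace ℝ (Fin N)),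
      CapInradius.poincareConst p Ω ≤
        ENNReal.ofReal (|C₀ γ| + 1) * (CapInradius.capInradius p γ Ω)⁻¹ ^ p := by
    intro γ hγ Ω
    exact hC₀ γ hγ _ (by linarith [le_abs_self (C₀ γ)]) (by positivity) Ω
  -- No control of `C₀` is needed: every admissible family of constants diverges.
  have hlim : Tendsto (fun γ : ℝ => |C₀ γ| + 1) (𝓝[<] 1) atTop :=
    CapInradius.tendsto_atTop_of_forall_poincareConst_le hN hp1 _
      fun γ _ hγ Ω _ => hup γ hγ Ω
  have hiff : ∀ Ω : Set (EuclideanSpace ℝ (Fin N)), ∀ γ : ℝ, 0 < γ → γ < 1 →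
      (0 < CapInradius.poincareConst p Ω ↔ CapInradius.capInradius p γ Ω < ⊤) := by
    intro Ω γ hγ0 hγ1
    constructor
    · intro h
      by_contra hR
      have h1 := hup γ hγ1 Ω
      rw [not_lt_top_iff.1 hR, ENNReal.inv_top, ENNReal.zero_rpow_of_pos hp0, mul_zero] at h1
      exact absurd h (not_lt.2 h1)
    · intro h
      refine lt_of_lt_of_le (ENNReal.mul_pos ?_ ?_) (hlow γ hγ0 hγ1 Ω)
      · exact (ENNReal.ofReal_pos.2 (mul_pos hσ hγ0)).ne'
      · rw [ENNReal.inv_rpow]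
        exact ENNReal.inv_ne_zero.2 (ENNReal.rpow_ne_top_of_nonneg hp0.le h.ne)
  exact ⟨⟨σ, hσ, _, fun γ hγ0 hγ1 Ω _ => ⟨hlow γ hγ0 hγ1 Ω, hup γ hγ1 Ω⟩, hlim⟩,
    fun C hC => CapInradius.tendsto_atTop_of_forall_poincareConst_le hN hp1 C hC,
    fun Ω _ => ⟨hiff Ω, fun γ γ' h0 h1 h0' h1' =>
      (hiff Ω γ h0 h1).symm.trans (hiff Ω γ' h0' h1')⟩⟩
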